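/- Let $N\in\mathbb N$, $T>0$, let $\mathbb T^N=\mathbb R^N/\mathbb Z^N$ be the flat torus and let $\Gamma=C([0,T];\mathbb T^N)$ carry the uniform topology; $\mathbb P(X)$ denotes the Borel probability measures on $X$ with the narrow topology. Let $H_0:\mathbb T^N\times[0,T]\times\mathbb R^N\to\mathbb R$ satisfy (H1) $H_0$ is continuous; (H2) $p\mapsto H_0(x,t,p)$ is convex for all $(x,t)$; (H3) $H_0(x,t,p)/|p|\to+\infty$ as $|p|\to+\infty$, uniformly in $(x,t)\in\mathbb T^N\times[0,T]$; (H4) $p\mapsto H_0(x,t,p)$ is differentiable on $\mathbb R^N$ for all $(x,t)$. Let $L_0(x,t,q)=\sup_{p}\,(p\cdot q-H_0(x,t,p))$ and let $g_0:\mathbb T^N\to\mathbb R$ be continuous. The action $\int_{a}^{b}L_0(\zeta,t,\dot\zeta)\,dt\in(-\infty,+\infty]$ of a continuous curve is set to $+\infty$ if the curve is not absolutely continuous. Put $$v(x,t)=\inf\Big\{g_0(\zeta(T))+\int_t^TL_0(\zeta,s,\dot\zeta)\,ds \;:\; \zeta:[t,T]\to\mathbb T^N,\ \zeta(t)=x\Big\}.$$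 A curve $\zeta_0\in\Gamma$ is $g_0$-optimal if it minimizes $g_0(\zeta(T))+\int_0^TL_0(\zeta,t,\dot\zeta)\,dt$ among all $\zeta\in\Gamma$ with $\zeta(0)=\zeta_0(0)$; a measure $\xi\in\mathbb P(\Gamma)$ is $g_0$-optimal if it is concentrated on $g_0$-optimal curves. Write $\xi(t)=\mathrm{ev}_t\#\xi\in\mathbb P(\mathbb T^N)$, where $\mathrm{ev}_t(\zeta)=\zeta(t)$. For $(x,t)\in\mathbb T^N\times(0,T)$ let $\mathcal W_{g_0}(x,t)$ be the set of $q\in\mathbb R^N$ such that $$\lim_{h\to0}\frac{v(x+hq,t+h)-v(x,t)}{h}=-L_0(x,t,q).$$ Then there is a Borel field $W:\mathbb T^N\times[0,T]\to\mathbb R^N$ with $\mathcal W_{g_0}(x,t)=\{W(x,t)\}$ whenever $t\in(0,T)$ and $\mathcal W_{g_0}(x,t)\neq\emptyset$; denote by $W_{g_0}$ any such field. Every $g_0$-optimal measure $\xi\in\mathbb P(\Gamma)$ satisfies: (i) The curve $t\mapsto\xi(t)$ solves the continuity equation driven by $W_{g_0}$, for every choice of $W_{g_0}$: it is narrowly continuous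 on $[0,T]$, $\int_0^T\!\int|W_{g_0}(x,t)|\,d\xi(t)(x)\,dt<\infty$, and for every $\varphi\in C^1(\mathbb T^N\times[0,T])$ $$\int_0^T\!\int\big(\varphi_t(x,t)+D\varphi(x,t)\cdot W_{g_0}(x,t)\big)\,d\xi(t)(x)\,dt=\int\varphi(\cdot,T)\,d\xi(T)-\int\varphi(\cdot,0)\,d\xi(0).$$ (ii) Let $\varepsilon_0>0$ and let $(1+\varepsilon_0)^*=(1+\varepsilon_0)/\varepsilon_0$ be the conjugate exponent of $1+\varepsilon_0$. If in addition (H5) $L_0(x,t,q)/|q|^{(1+\varepsilon_0)^*}\to+\infty$ as $|q|\to+\infty$, uniformly in $(x,t)\in\mathbb T^N\times[0,T]$, then $t\mapsto\xi(t)$ is $(1+\varepsilon_0)^*$-absolutely continuous: there is $f\in L^{(1+\varepsilon_0)^*}([0,T])$ with $d_W(\xi(t_1),\xi(t_2))\le\int_{t_1}^{t_2}f(t)\,dt$ for all $t_1<t_2$ in $[0,T]$, where $d_W$ is the first Wasserstein distance. -/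

import Mathlib

open Set Filter Topology MeasureTheory

noncomputable section

namespace MFG

/-- The velocity (and momentum) space `ℝᴺ`, with its Euclidean norm. -/
abbrev Vel (N : ℕ) : Type := EuclideanSpace ℝ (Fin N)

/-- The flat torus `ℝᴺ / ℤᴺ`: the `ℓ²`-product of `N` circles of length one, so that its distance is
the flat Euclidean one. -/
abbrev Torus (N : ℕ) : Type := PiLp 2 (fun _ : Fin N => UnitAddCircle)

/-- The canonical projection `ℝᴺ → ℝᴺ / ℤᴺ`. -/
def proj {N : ℕ} (q : Vel N) : Torus N := WithLp.toLp 2 fun i => (q i : UnitAddCircle)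

/-! ### Hamiltonian and Lagrangian

Functions of time are defined on `ℝ`, but only their values for times in `[0, T]` are used. -/

/-- Continuity of the Hamiltonian in all its arguments on `𝕋ᴺ × [0, T] × ℝᴺ`. -/
def IsContHam {N : ℕ} (T : ℝ) (H₀ : Torus N → ℝ → Vel N → ℝ) : Prop :=
  ContinuousOn (fun z : Torus N × ℝ × Vel N => H₀ z.1 z.2.1 z.2.2)
    (univ ×ˢ Icc 0 T ×ˢ univ)

/-- Convexity of the Hamiltonian in the momentum. -/
def IsConvexHam {N : ℕ} (T : ℝ) (H₀ : Torus N → ℝ → Vel N → ℝ) : Prop :=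
  ∀ x : Torus N, ∀ t ∈ Icc 0 T, ConvexOn ℝ univ (H₀ x t)

/-- `F(x, t, p) / |p| ^ r → +∞` as `|p| → +∞`, uniformly for `(x, t) ∈ 𝕋ᴺ × [0, T]`. -/
def UniformlySuperpower {N : ℕ} (T r : ℝ) (F : Torus N → ℝ → Vel N → ℝ) : Prop :=
  ∀ K : ℝ, ∃ R : ℝ, ∀ x : Torus N, ∀ t ∈ Icc 0 T, ∀ p : Vel N,
    R < ‖p‖ → 0 < ‖p‖ → K ≤ F x t p / ‖p‖ ^ r

/-- Differentiability of the Hamiltonian in the momentum. -/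
def IsDiffHam {N : ℕ} (T : ℝ) (H₀ : Torus N → ℝ → Vel N → ℝ) : Prop :=
  ∀ x : Torus N, ∀ t ∈ Icc 0 T, Differentiable ℝ (H₀ x t)

/-- The Lagrangian, i.e. the Fenchel transform of the Hamiltonian in the momentum. -/
def lagrangian {N : ℕ} (H₀ : Torus N → ℝ → Vel N → ℝ) (x : Torus N) (t : ℝ) (q : Vel N) : ℝ :=
  ⨆ p : Vel N, (inner ℝ p q - H₀ x t p)

/-! ### Curves and action -/

/-- The curve `ζ` in the torus is differentiable at `t` with velocity `q`: near `t` it is the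
projection of a curve in `ℝᴺ` with derivative `q` at `t`. -/
def HasVelocityAt {N : ℕ} (ζ : ℝ → Torus N) (q : Vel N) (t : ℝ) : Prop :=
  ∃ c : ℝ → Vel N, HasDerivAt c q t ∧ ∀ᶠ s in 𝓝 t, ζ s = proj (c s)

open Classical in
/-- The velocity of a curve in the torus (zero where the curve is not differentiable). -/
def velocity {N : ℕ} (ζ : ℝ → Torus N) (t : ℝ) : Vel N :=
  if h : ∃ q, HasVelocityAt ζ q t then h.choose else 0

open Classical in
/-- The action `∫ₐᵇ L(ζ, t, ζ') dt` of `ζ` on `[a, b]`. It is `+∞` if `ζ` is not absolutely continuous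
on `[a, b]`. Since the Lagrangians used below are continuous and bounded from below, the integral along
an absolutely continuous curve is `+∞` exactly if the integrand is not integrable. -/
def action {N : ℕ} (L : Torus N → ℝ → Vel N → ℝ) (ζ : ℝ → Torus N) (a b : ℝ) : EReal :=
  if AbsolutelyContinuousOnInterval ζ a b ∧
      IntervalIntegrable (fun t => L (ζ t) t (velocity ζ t)) volume a b
  then ((∫ t in a..b, L (ζ t) t (velocity ζ t) : ℝ) : EReal)
  else ⊤

/-- The value function given by the Lax–Oleinik formula:
`v(x, t) = inf { g₀(ζ(T)) + ∫ₜᵀ L₀(ζ, s, ζ') ds | ζ(t) = x }`. -/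
def valueFun {N : ℕ} (T : ℝ) (H₀ : Torus N → ℝ → Vel N → ℝ) (g₀ : Torus N → ℝ)
    (x : Torus N) (t : ℝ) : ℝ :=
  (⨅ (ζ : ℝ → Torus N) (_ : ζ t = x),
    ((g₀ (ζ T) : ℝ) : EReal) + action (lagrangian H₀) ζ t T).toReal

/-! ### The space of continuous curves and optimal measures -/

/-- The space `Γ` of continuous curves `[0, T] → 𝕋ᴺ` with the uniform topology. -/
abbrev CurveSpace (N : ℕ) (T : ℝ) : Type := C(Icc (0 : ℝ) T, Torus N)

instance instMeasurableSpaceCurveSpace (N : ℕ) (T : ℝ) : MeasurableSpace (CurveSpace N T) :=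
  borel _

instance instBorelSpaceCurveSpace (N : ℕ) (T : ℝ) : BorelSpace (CurveSpace N T) := ⟨rfl⟩

/-- The curve `ζ ∈ Γ` as a function on `ℝ`, extended by its end values outside `[0, T]`. -/
def CurveSpace.ext {N : ℕ} {T : ℝ} (hT : 0 ≤ T) (ζ : CurveSpace N T) : ℝ → Torus N :=
  IccExtend hT ζ

/-- The total cost `g₀(ζ(T)) + ∫₀ᵀ L₀(ζ, t, ζ') dt` of `ζ ∈ Γ`. -/
def totalCost {N : ℕ} {T : ℝ} (hT : 0 ≤ T) (H₀ : Torus N → ℝ → Vel N → ℝ) (g₀ : Torus N → ℝ)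
    (ζ : CurveSpace N T) : EReal :=
  ((g₀ (ζ.ext hT T) : ℝ) : EReal) + action (lagrangian H₀) (ζ.ext hT) 0 T

/-- `ζ₀` is `g₀`-optimal: it minimizes the total cost among the curves of `Γ` with the same initial
point. -/
def IsOptimalCurve {N : ℕ} {T : ℝ} (hT : 0 ≤ T) (H₀ : Torus N → ℝ → Vel N → ℝ)
    (g₀ : Torus N → ℝ) (ζ₀ : CurveSpace N T) : Prop :=
  ∀ ζ : CurveSpace N T, ζ.ext hT 0 = ζ₀.ext hT 0 → totalCost hT H₀ g₀ ζ₀ ≤ totalCost hT H₀ g₀ ζ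

/-- `ξ ∈ ℙ(Γ)` is `g₀`-optimal: it is concentrated on `g₀`-optimal curves. -/
def IsOptimalMeasure {N : ℕ} {T : ℝ} (hT : 0 ≤ T) (H₀ : Torus N → ℝ → Vel N → ℝ)
    (g₀ : Torus N → ℝ) (ξ : ProbabilityMeasure (CurveSpace N T)) : Prop :=
  ∀ᵐ ζ ∂(ξ : Measure (CurveSpace N T)), IsOptimalCurve hT H₀ g₀ ζ

theorem CurveSpace.continuous_eval {N : ℕ} {T : ℝ} (hT : 0 ≤ T) (t : ℝ) :
    Continuous fun ζ : CurveSpace N T => ζ.ext hT t :=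
  continuous_eval_const (F := CurveSpace N T) (projIcc 0 T hT t)

/-- The evaluation curve `t ↦ ξ(t) = ev_t # ξ`. -/
def evalCurve {N : ℕ} {T : ℝ} (hT : 0 ≤ T) (ξ : ProbabilityMeasure (CurveSpace N T)) (t : ℝ) :
    ProbabilityMeasure (Torus N) :=
  ξ.map (f := fun ζ : CurveSpace N T => ζ.ext hT t)
    (CurveSpace.continuous_eval hT t).measurable.aemeasurable

/-! ### The vector field -/

/-- The set `𝒲_{g₀}(x, t)` of the vectors `q` such that the derivative of the value function `v` at
`(x, t)` in the space-time direction `(q, 1)` exists and equals `-L₀(x, t, q)`. -/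
def fieldSet {N : ℕ} (T : ℝ) (H₀ : Torus N → ℝ → Vel N → ℝ) (g₀ : Torus N → ℝ)
    (x : Torus N) (t : ℝ) : Set (Vel N) :=
  {q | HasDerivAt (fun h : ℝ => valueFun T H₀ g₀ (x + proj (h • q)) (t + h))
    (-lagrangian H₀ x t q) 0}

/-- `W` is a version of the Borel field `W_{g₀}`: a Borel field such that, for every
`(x, t) ∈ 𝕋ᴺ × (0, T)` where `𝒲_{g₀}(x, t)` is non-empty, `W(x, t)` is its only element. -/
def IsOptimalField {N : ℕ} (T : ℝ) (H₀ : Torus N → ℝ → Vel N → ℝ) (g₀ : Torus N → ℝ)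
    (W : Torus N × ℝ → Vel N) : Prop :=
  Measurable W ∧ ∀ x : Torus N, ∀ t ∈ Ioo 0 T,
    (fieldSet T H₀ g₀ x t).Nonempty → fieldSet T H₀ g₀ x t = {W (x, t)}

/-! ### Continuity equation and absolutely continuous curves of measures -/

/-- `φ` is of class `C¹` on `𝕋ᴺ × [0, T]` (up to the boundary). -/
def IsC1 {N : ℕ} (T : ℝ) (φ : Torus N → ℝ → ℝ) : Prop :=
  ContDiffOn ℝ 1 (fun z : Vel N × ℝ => φ (proj z.1) z.2) (univ ×ˢ Icc 0 T)

/-- `φ_t(x, t) + Dφ(x, t) · w`, for `t ∈ [0, T]`. -/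
def transport {N : ℕ} (T : ℝ) (φ : Torus N → ℝ → ℝ) (x : Torus N) (t : ℝ) (w : Vel N) : ℝ :=
  derivWithin (fun s => φ x s) (Icc 0 T) t + fderiv ℝ (fun y : Vel N => φ (x + proj y) t) 0 w

/-- The narrowly continuous curve `μ` in `ℙ(𝕋ᴺ)` solves the continuity equation
`∂ₜ μ + ∇ · (μ W) = 0` in `𝕋ᴺ × [0, T]`, in the sense that the chain rule holds for every test function
of class `C¹`. The bound on `∫₀ᵀ ∫ |W| dμ(t) dt` says that the integrals in the chain rule exist. -/
def SolvesContinuityEq {N : ℕ} (T : ℝ) (μ : ℝ → ProbabilityMeasure (Torus N))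
    (W : Torus N × ℝ → Vel N) : Prop :=
  ContinuousOn μ (Icc 0 T) ∧
  (∫⁻ t in Icc 0 T, ∫⁻ x, ‖W (x, t)‖ₑ ∂(μ t : Measure (Torus N))) < ⊤ ∧
  ∀ φ : Torus N → ℝ → ℝ, IsC1 T φ →
    ∫ t in (0 : ℝ)..T, ∫ x, transport T φ x t (W (x, t)) ∂(μ t : Measure (Torus N)) =
      (∫ x, φ x T ∂(μ T : Measure (Torus N))) - ∫ x, φ x 0 ∂(μ 0 : Measure (Torus N))

/-- The first Wasserstein distance: the infimum of `∫ |x - y| dγ` over the transport plans `γ`. -/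
def wasserstein {N : ℕ} (μ ν : ProbabilityMeasure (Torus N)) : ENNReal :=
  ⨅ (γ : Measure (Torus N × Torus N)) (_ : γ.map Prod.fst = μ ∧ γ.map Prod.snd = ν),
    ∫⁻ z, edist z.1 z.2 ∂γ

/-- The curve `μ` in `ℙ(𝕋ᴺ)` is `r`-absolutely continuous on `[0, T]`. -/
def IsACMeasureCurve {N : ℕ} (T r : ℝ) (μ : ℝ → ProbabilityMeasure (Torus N)) : Prop :=
  ∃ f : ℝ → ℝ, MemLp f (ENNReal.ofReal r) (volume.restrict (Icc 0 T)) ∧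
    ∀ t₁ ∈ Icc 0 T, ∀ t₂ ∈ Icc 0 T, t₁ < t₂ →
      wasserstein (μ t₁) (μ t₂) ≤ ENNReal.ofReal (∫ t in t₁..t₂, f t)

end MFG

end

noncomputable section

namespace MFG

/-! An optimal measure is carried by curves that all follow one velocity field, so the continuity
equation is the chain rule along single curves, integrated in `ξ` by Fubini.

Three properties of the Lagrangian suffice (`IsTonelli`): continuity, growth at least linear in `q`,
and strict midpoint convexity, which comes from the differentiability of `H₀` in `p`. The field has
at most one value (`fieldSet_subsingleton`): if `q₁` and `q₂` both belong to it, the straight path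
from `x - h q₁` to `x + h q₂` during `[t - h, t + h]` has velocity `(q₁ + q₂) / 2`. Dynamic
programming along it gives `L(q₁) + L(q₂) ≤ 2 L((q₁ + q₂) / 2)`, hence `q₁ = q₂`. An optimal curve
has, at almost every time, a velocity in the field (`mem_fieldSet_of_hasDerivAt`,
`IsOptimalCurve.exists_lift`), because the value function decreases along it at exactly the rate
`L`.

No continuity of the value function `v` is used. For Borel measurability, `v + C t` is monotone
along motions of speed at most `R`. Its infimum over the open forward cone is a Borel function that
decides differentiability in directions of speed less than `R` by rational increments
(`ConeMonotone.hasDerivAt_iff`). So the graph of the field is Borel, and since it projects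
injectively, the selection is Borel by Lusin–Souslin.

Comparison with constant curves bounds the action of optimal curves uniformly, which yields
integrability of the speed, and of its power under (H5). The mean speed at time `t` then bounds the
Wasserstein increments, and Jensen's inequality gives its integrability. -/

instance instCompactSpaceTorus (N : ℕ) : CompactSpace (Torus N) :=
  (PiLp.homeomorph 2 (fun _ : Fin N => UnitAddCircle)).symm.compactSpace

/-- The properties of the Lagrangian on which the theory of optimal curves rests. -/
structure IsTonelli {N : ℕ} (T : ℝ) (L : Torus N → ℝ → Vel N → ℝ) : Prop where
  continuousOn : ContinuousOn (fun z : Torus N × ℝ × Vel N => L z.1 z.2.1 z.2.2)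
    (univ ×ˢ Icc 0 T ×ˢ univ)
  coercive : ∃ C : ℝ, 0 ≤ C ∧ ∀ x : Torus N, ∀ t ∈ Icc 0 T, ∀ q, ‖q‖ - C ≤ L x t q
  eq_of_midpoint_le : ∀ x : Torus N, ∀ t ∈ Icc 0 T, ∀ q₁ q₂,
    L x t q₁ + L x t q₂ ≤ 2 * L x t ((2 : ℝ)⁻¹ • (q₁ + q₂)) → q₁ = q₂

/-! ### Fenchel duality: regularity of the Lagrangian -/

section Lagrangian

variable {N : ℕ} {T : ℝ} {H₀ : Torus N → ℝ → Vel N → ℝ}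

theorem IsContHam.exists_bound (hcont : IsContHam T H₀) (R : ℝ) :
    ∃ M : ℝ, 0 ≤ M ∧ ∀ x : Torus N, ∀ t ∈ Icc 0 T, ∀ p, ‖p‖ ≤ R → |H₀ x t p| ≤ M := by
  have hK : IsCompact ((univ : Set (Torus N)) ×ˢ Icc 0 T ×ˢ Metric.closedBall (0 : Vel N) R) :=
    isCompact_univ.prod (isCompact_Icc.prod (isCompact_closedBall _ _))
  obtain ⟨M, hM⟩ := hK.exists_bound_of_continuousOn
    (hcont.mono (prod_mono_right (prod_mono_right (subset_univ _))))
  refine ⟨max M 0, le_max_right _ _, fun x t ht p hp => le_max_of_le_left ?_⟩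
  exact hM (x, t, p) ⟨mem_univ _, ht, by simpa using hp⟩

/-- Superlinearity with constant `Q + 1` makes the objective at most `-‖p‖`, which is below its
value at `p = 0` once `‖p‖` exceeds the bound of `|H₀(·, ·, 0)|`. Hence the supremum lives on a ball
that is uniform in `(x, t)` and in `‖q‖ ≤ Q`. -/
theorem exists_radius_of_superlinear (hcont : IsContHam T H₀) (hsuper : UniformlySuperpower T 1 H₀)
    (Q : ℝ) : ∃ R : ℝ, 0 ≤ R ∧ ∀ x : Torus N, ∀ t ∈ Icc 0 T, ∀ q : Vel N, ‖q‖ ≤ Q → ∀ p,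
      R < ‖p‖ → inner ℝ p q - H₀ x t p ≤ inner ℝ 0 q - H₀ x t 0 := by
  obtain ⟨R, hR⟩ := hsuper (Q + 1)
  obtain ⟨M, hM0, hM⟩ := hcont.exists_bound 0
  refine ⟨max R M, le_max_of_le_right hM0, fun x t ht q hq p hp => ?_⟩
  have hp0 : 0 < ‖p‖ := (le_max_of_le_right hM0).trans_lt hp
  have h1 := hR x t ht p ((le_max_left _ _).trans_lt hp) hp0
  rw [Real.rpow_one, le_div_iff₀ hp0] at h1
  have h2 := (le_abs_self _).trans (hM x t ht 0 (by simp))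
  have h3 := real_inner_le_norm p q
  have h4 : M < ‖p‖ := (le_max_right _ _).trans_lt hp
  have h5 : ‖p‖ * ‖q‖ ≤ ‖p‖ * Q := by gcongr
  rw [inner_zero_left]
  nlinarith

theorem exists_isMax_lagrangian (hcont : IsContHam T H₀) (hsuper : UniformlySuperpower T 1 H₀)
    (Q : ℝ) : ∃ R : ℝ, 0 ≤ R ∧ ∀ x : Torus N, ∀ t ∈ Icc 0 T, ∀ q : Vel N, ‖q‖ ≤ Q →
      ∃ p, ‖p‖ ≤ R ∧ ∀ p', inner ℝ p' q - H₀ x t p' ≤ inner ℝ p q - H₀ x t p := by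
  obtain ⟨R, hR0, hR⟩ := exists_radius_of_superlinear hcont hsuper Q
  refine ⟨R, hR0, fun x t ht q hq => ?_⟩
  have hc : ContinuousOn (fun p => inner ℝ p q - H₀ x t p) (Metric.closedBall (0 : Vel N) R) := by
    refine ContinuousOn.sub (by fun_prop) ?_
    exact ContinuousOn.comp (f := fun p => (x, t, p)) hcont (by fun_prop)
      fun p _ => ⟨mem_univ _, ht, mem_univ _⟩
  obtain ⟨p, hp, hmax⟩ := (isCompact_closedBall (0 : Vel N) R).exists_isMaxOn
    ⟨0, by simpa using hR0⟩ hc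
  refine ⟨p, by simpa using hp, fun p' => ?_⟩
  by_cases hp' : ‖p'‖ ≤ R
  · exact hmax (by simpa using hp' : p' ∈ Metric.closedBall (0 : Vel N) R)
  · exact (hR x t ht q hq p' (not_le.1 hp')).trans
      (hmax (by simpa using hR0 : (0 : Vel N) ∈ Metric.closedBall (0 : Vel N) R))

theorem inner_sub_le_lagrangian (hcont : IsContHam T H₀) (hsuper : UniformlySuperpower T 1 H₀)
    (x : Torus N) {t : ℝ} (ht : t ∈ Icc 0 T) (q p : Vel N) :
    inner ℝ p q - H₀ x t p ≤ lagrangian H₀ x t q := by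
  obtain ⟨R, -, hR⟩ := exists_isMax_lagrangian hcont hsuper ‖q‖
  obtain ⟨p₀, -, hp₀⟩ := hR x t ht q le_rfl
  exact le_ciSup (f := fun p => inner ℝ p q - H₀ x t p)
    ⟨_, by rintro _ ⟨p', rfl⟩; exact hp₀ p'⟩ p

theorem lagrangian_eq_of_isMax {x : Torus N} {t : ℝ} {q p : Vel N}
    (hp : ∀ p', inner ℝ p' q - H₀ x t p' ≤ inner ℝ p q - H₀ x t p) :
    lagrangian H₀ x t q = inner ℝ p q - H₀ x t p :=
  le_antisymm (ciSup_le hp) (le_ciSup (f := fun p => inner ℝ p q - H₀ x t p)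
    ⟨_, by rintro _ ⟨p', rfl⟩; exact hp p'⟩ p)

theorem continuousOn_lagrangian (hT : 0 ≤ T) (hcont : IsContHam T H₀)
    (hsuper : UniformlySuperpower T 1 H₀) :
    ContinuousOn (fun z : Torus N × ℝ × Vel N => lagrangian H₀ z.1 z.2.1 z.2.2)
      (univ ×ˢ Icc 0 T ×ˢ univ) := by
  rintro ⟨x₀, t₀, q₀⟩ ⟨-, ht₀, -⟩
  obtain ⟨R, hR0, hR⟩ := exists_isMax_lagrangian hcont hsuper (‖q₀‖ + 1)
  -- Clamping time to `[0, T]` makes `f` continuous everywhere, so its supremum over a compact ball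
  -- is continuous.
  let f : (Torus N × ℝ × Vel N) → Vel N → ℝ := fun z p =>
    inner ℝ p z.2.2 - H₀ z.1 (projIcc 0 T hT z.2.1) p
  have hf : Continuous ↿f := by
    refine Continuous.sub (by fun_prop) ?_
    have : Continuous fun y : (Torus N × ℝ × Vel N) × Vel N =>
        (y.1.1, (projIcc 0 T hT y.1.2.1 : ℝ), y.2) := by
      have := continuous_projIcc (h := hT)
      fun_prop
    exact hcont.comp_continuous this fun y => ⟨mem_univ _, (projIcc 0 T hT _).2, mem_univ _⟩
  have hs := (isCompact_closedBall (0 : Vel N) R).continuous_sSup hf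
  have key : ∀ z : Torus N × ℝ × Vel N, z.2.1 ∈ Icc 0 T → ‖z.2.2‖ ≤ ‖q₀‖ + 1 →
      lagrangian H₀ z.1 z.2.1 z.2.2 = sSup (f z '' Metric.closedBall 0 R) := by
    intro z ht hz
    obtain ⟨p, hp, hmax⟩ := hR z.1 z.2.1 ht z.2.2 hz
    have hf' : f z = fun p => inner ℝ p z.2.2 - H₀ z.1 z.2.1 p := by
      simp only [f, projIcc_of_mem hT ht]
    rw [lagrangian_eq_of_isMax hmax, hf']
    have hpR : p ∈ Metric.closedBall (0 : Vel N) R := by simpa using hp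
    refine (IsGreatest.csSup_eq ⟨mem_image_of_mem (fun p => inner ℝ p z.2.2 - H₀ z.1 z.2.1 p) hpR,
      ?_⟩).symm
    rintro _ ⟨p', -, rfl⟩
    exact hmax p'
  refine (hs.continuousAt (x := (x₀, t₀, q₀))).continuousWithinAt.congr_of_eventuallyEq ?_
    (key _ ht₀ (by simp))
  have hq : ∀ᶠ z : Torus N × ℝ × Vel N in 𝓝 (x₀, t₀, q₀), ‖z.2.2‖ < ‖q₀‖ + 1 :=
    (by fun_prop : Continuous fun z : Torus N × ℝ × Vel N => ‖z.2.2‖).continuousAt.eventually_lt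
      continuousAt_const (by simp)
  filter_upwards [mem_nhdsWithin_of_mem_nhds hq, self_mem_nhdsWithin] with z hz hz'
  exact key z hz'.2.1 hz.le

theorem gradient_eq_of_isMax {x : Torus N} {t : ℝ} (hd : Differentiable ℝ (H₀ x t)) {q p : Vel N}
    (hp : ∀ p', inner ℝ p' q - H₀ x t p' ≤ inner ℝ p q - H₀ x t p) :
    fderiv ℝ (H₀ x t) p = innerSL ℝ q := by
  have h1 : IsLocalMax (fun p' => innerSL ℝ q p' - H₀ x t p') p :=
    Filter.Eventually.of_forall fun p' => by
      simpa only [innerSL_apply_apply, real_inner_comm] using hp p'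
  have h2 := h1.hasFDerivAt_eq_zero ((innerSL ℝ q).hasFDerivAt.sub (hd p).hasFDerivAt)
  exact (sub_eq_zero.1 h2).symm

theorem isTonelli_lagrangian (hT : 0 ≤ T) (hcont : IsContHam T H₀)
    (hsuper : UniformlySuperpower T 1 H₀) (hdiff : IsDiffHam T H₀) :
    IsTonelli T (lagrangian H₀) where
  continuousOn := continuousOn_lagrangian hT hcont hsuper
  coercive := by
    obtain ⟨M, hM0, hM⟩ := hcont.exists_bound 1
    refine ⟨M, hM0, fun x t ht q => ?_⟩
    -- The momentum `q / ‖q‖` in the supremum gives `‖q‖` minus the bound of `H₀` on the unit ball.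
    refine le_trans ?_ (inner_sub_le_lagrangian hcont hsuper x ht q (‖q‖⁻¹ • q))
    have h1 : ‖‖q‖⁻¹ • q‖ ≤ 1 := by
      rw [norm_smul, norm_inv, norm_norm]
      exact inv_mul_le_one
    have h2 : inner ℝ (‖q‖⁻¹ • q) q = ‖q‖ := by
      rw [real_inner_smul_left, real_inner_self_eq_norm_sq]
      by_cases h : ‖q‖ = 0
      · simp [h]
      · field_simp
    have := (le_abs_self _).trans (hM x t ht _ h1)
    linarith
  eq_of_midpoint_le := by
    intro x t ht q₁ q₂ h
    obtain ⟨R, -, hR⟩ := exists_isMax_lagrangian hcont hsuper ‖(2 : ℝ)⁻¹ • (q₁ + q₂)‖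
    obtain ⟨p, -, hp⟩ := hR x t ht _ le_rfl
    rw [lagrangian_eq_of_isMax hp, real_inner_smul_right, inner_add_right] at h
    have h1 := inner_sub_le_lagrangian hcont hsuper x ht q₁
    have h2 := inner_sub_le_lagrangian hcont hsuper x ht q₂
    -- The midpoint inequality forces a maximizer `p` for the midpoint to be a maximizer for `q₁`
    -- and for `q₂`. The gradient of `H₀` at `p` then equals both.
    have e1 := gradient_eq_of_isMax (hdiff x t ht) (q := q₁) (p := p) fun p' => by
      linarith [h1 p', h1 p, h2 p]
    have e2 := gradient_eq_of_isMax (hdiff x t ht) (q := q₂) (p := p) fun p' => by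
      linarith [h2 p', h1 p, h2 p]
    exact (innerSL_inj (𝕜 := ℝ)).1 (e1.symm.trans e2)

end Lagrangian

/-! ### The covering map from `ℝᴺ` to the torus -/

section Projection

variable {N : ℕ}

theorem proj_add (a b : Vel N) : proj (a + b) = proj a + proj b := by
  ext i; simp [proj]

theorem proj_sub (a b : Vel N) : proj (a - b) = proj a - proj b := by
  ext i; simp [proj]

theorem proj_zero : proj (0 : Vel N) = 0 := by
  ext i; simp [proj]

theorem norm_proj_le (a : Vel N) : ‖proj a‖ ≤ ‖a‖ := by
  rw [PiLp.norm_eq_of_L2, EuclideanSpace.norm_eq]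
  refine Real.sqrt_le_sqrt (Finset.sum_le_sum fun i _ => ?_)
  gcongr
  exact QuotientAddGroup.norm_mk_le_norm

theorem lipschitzWith_proj : LipschitzWith 1 (proj : Vel N → Torus N) :=
  LipschitzWith.of_dist_le_mul fun a b => by
    rw [dist_eq_norm, dist_eq_norm, ← proj_sub, NNReal.coe_one, one_mul]
    exact norm_proj_le _

theorem continuous_proj : Continuous (proj : Vel N → Torus N) :=
  lipschitzWith_proj.continuous

theorem exists_proj_eq_norm_eq (x : Torus N) : ∃ a : Vel N, proj a = x ∧ ‖a‖ = ‖x‖ := by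
  have h : ∀ y : UnitAddCircle, ∃ r : ℝ, (r : UnitAddCircle) = y ∧ |r| = ‖y‖ := by
    intro y
    obtain ⟨r, rfl⟩ := QuotientAddGroup.mk_surjective y
    -- Subtracting the nearest integer gives the representative of least absolute value.
    refine ⟨r - round r, ?_, (UnitAddCircle.norm_eq).symm⟩
    rw [AddCircle.coe_sub, sub_eq_self]
    exact AddCircle.coe_eq_zero_iff 1 |>.2 ⟨round r, by simp⟩
  choose r hr hr' using h
  refine ⟨WithLp.toLp 2 fun i => r (x i), ?_, ?_⟩
  · ext i; simp [proj, hr]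
  · rw [EuclideanSpace.norm_eq, PiLp.norm_eq_of_L2]
    simp [hr']

theorem exists_proj_eq (x : Torus N) : ∃ a : Vel N, proj a = x :=
  (exists_proj_eq_norm_eq x).imp fun _ h => h.1

theorem norm_proj_eq {a : Vel N} (ha : ‖a‖ < 1 / 2) : ‖proj a‖ = ‖a‖ := by
  rw [PiLp.norm_eq_of_L2, EuclideanSpace.norm_eq]
  congr 1
  refine Finset.sum_congr rfl fun i _ => ?_
  congr 1
  have h : |a i| ≤ 1 / 2 := by
    simpa using (PiLp.norm_apply_le a i).trans ha.le
  exact (AddCircle.norm_coe_eq_abs_iff 1 one_ne_zero).2 (by simpa using h)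

end Projection

/-! ### Velocities of curves and straight segments -/

section Velocity

variable {N : ℕ} {ζ η : ℝ → Torus N} {t : ℝ} {q q₁ q₂ : Vel N}

theorem HasVelocityAt.unique (h₁ : HasVelocityAt ζ q₁ t) (h₂ : HasVelocityAt ζ q₂ t) : q₁ = q₂ := by
  obtain ⟨c₁, hd₁, hc₁⟩ := h₁
  obtain ⟨c₂, hd₂, hc₂⟩ := h₂
  have hd := hd₁.sub hd₂
  -- The difference of two lifts is continuous with values in the lattice, hence locally constant.
  have hzero : ∀ᶠ s in 𝓝 t, (c₁ - c₂) s = (c₁ - c₂) t := by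
    have hnear : ∀ᶠ s in 𝓝 t, ‖(c₁ - c₂) s - (c₁ - c₂) t‖ < 1 / 2 := by
      have := hd.continuousAt.eventually (Metric.ball_mem_nhds _ (by norm_num : (0 : ℝ) < 1 / 2))
      filter_upwards [this] with s hs
      rwa [dist_eq_norm] at hs
    have ht₁ := hc₁.self_of_nhds
    have ht₂ := hc₂.self_of_nhds
    filter_upwards [hnear, hc₁, hc₂] with s hs h₁ h₂
    have h := norm_proj_eq hs
    rw [Pi.sub_apply, Pi.sub_apply, proj_sub, proj_sub, proj_sub, ← h₁, ← h₂, ← ht₁, ← ht₂,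
      sub_self, sub_self, sub_self, norm_zero] at h
    exact sub_eq_zero.1 (norm_eq_zero.1 h.symm)
  exact sub_eq_zero.1 (hd.unique ((hasDerivAt_const t ((c₁ - c₂) t)).congr_of_eventuallyEq hzero))

theorem HasVelocityAt.velocity_eq (h : HasVelocityAt ζ q t) : velocity ζ t = q := by
  have hex : ∃ q, HasVelocityAt ζ q t := ⟨q, h⟩
  rw [velocity, dif_pos hex]
  exact hex.choose_spec.unique h

theorem HasVelocityAt.congr (h : HasVelocityAt ζ q t) (he : η =ᶠ[𝓝 t] ζ) : HasVelocityAt η q t := by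
  obtain ⟨c, hd, hc⟩ := h
  exact ⟨c, hd, he.trans hc⟩

theorem velocity_congr (he : ζ =ᶠ[𝓝 t] η) : velocity ζ t = velocity η t := by
  by_cases h : ∃ q, HasVelocityAt η q t
  · obtain ⟨q, hq⟩ := h
    rw [hq.velocity_eq, (hq.congr he).velocity_eq]
  · have h' : ¬ ∃ q, HasVelocityAt ζ q t := fun ⟨q, hq⟩ => h ⟨q, hq.congr he.symm⟩
    rw [velocity, velocity, dif_neg h, dif_neg h']

/-- The curve with constant velocity `q` passing through `x` at time `t`. -/
def segment (x : Torus N) (t : ℝ) (q : Vel N) (s : ℝ) : Torus N := x + proj ((s - t) • q)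

theorem segment_self (x : Torus N) (t : ℝ) (q : Vel N) : segment x t q t = x := by
  simp [segment, proj_zero]

theorem hasVelocityAt_segment (x : Torus N) (t : ℝ) (q : Vel N) (s : ℝ) :
    HasVelocityAt (segment x t q) q s := by
  obtain ⟨a, rfl⟩ := exists_proj_eq x
  refine ⟨fun s => a + (s - t) • q, ?_, Eventually.of_forall fun s => ?_⟩
  · simpa using (((hasDerivAt_id s).sub_const t).smul_const q).const_add a
  · rw [segment, proj_add]

theorem velocity_segment (x : Torus N) (t : ℝ) (q : Vel N) (s : ℝ) :
    velocity (segment x t q) s = q :=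
  (hasVelocityAt_segment x t q s).velocity_eq

theorem lipschitzWith_segment (x : Torus N) (t : ℝ) (q : Vel N) :
    LipschitzWith ‖q‖₊ (segment x t q) :=
  LipschitzWith.of_dist_le_mul fun s s' => by
    rw [segment, segment, dist_add_left]
    refine (lipschitzWith_proj.dist_le_mul _ _).trans ?_
    rw [dist_eq_norm, ← sub_smul, norm_smul, sub_sub_sub_cancel_right, ← dist_eq_norm, coe_nnnorm,
      NNReal.coe_one, one_mul, mul_comm]

theorem continuous_segment (x : Torus N) (t : ℝ) (q : Vel N) : Continuous (segment x t q) :=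
  (lipschitzWith_segment x t q).continuous

end Velocity

/-! ### Absolute continuity: congruence and gluing -/

section AbsolutelyContinuous

variable {X : Type*} [PseudoMetricSpace X] {f g : ℝ → X} {a b c : ℝ}

open AbsolutelyContinuousOnInterval in
theorem _root_.AbsolutelyContinuousOnInterval.congr (hf : AbsolutelyContinuousOnInterval f a b)
    (h : EqOn f g (uIcc a b)) : AbsolutelyContinuousOnInterval g a b := by
  rw [absolutelyContinuousOnInterval_iff] at hf ⊢
  intro ε hε
  obtain ⟨δ, hδ, H⟩ := hf ε hε
  refine ⟨δ, hδ, fun E hE hEδ => ?_⟩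
  convert! H E hE hEδ using 1
  refine Finset.sum_congr rfl fun i hi => ?_
  rw [h (hE.1 i hi).1, h (hE.1 i hi).2]

open AbsolutelyContinuousOnInterval in
theorem _root_.AbsolutelyContinuousOnInterval.trans (hab : a ≤ b) (hbc : b ≤ c)
    (h₁ : AbsolutelyContinuousOnInterval f a b) (h₂ : AbsolutelyContinuousOnInterval f b c) :
    AbsolutelyContinuousOnInterval f a c := by
  rw [absolutelyContinuousOnInterval_iff] at h₁ h₂ ⊢
  intro ε hε
  obtain ⟨δ₁, hδ₁, H₁⟩ := h₁ (ε / 2) (half_pos hε)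
  obtain ⟨δ₂, hδ₂, H₂⟩ := h₂ (ε / 2) (half_pos hε)
  refine ⟨min δ₁ δ₂, lt_min hδ₁ hδ₂, fun E hE hEδ => ?_⟩
  have hmem := hE.1
  simp only [uIcc_of_le (hab.trans hbc), mem_Icc] at hmem
  have hlen : ∀ u v : ℝ, dist (min u b) (min v b) ≤ dist u v ∧
      dist (max u b) (max v b) ≤ dist u v := by
    intro u v
    simp only [Real.dist_eq]
    exact ⟨by simpa using abs_min_sub_min_le_max u b v b,
      by simpa using abs_max_sub_max_le_max u b v b⟩
  -- Clamping the end points at `b` cuts each interval into its parts left and right of `b`; a part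
  -- on the wrong side degenerates to a point.
  have hE₁ : (E.1, fun i => (min (E.2 i).1 b, min (E.2 i).2 b)) ∈ disjWithin a b := by
    refine ⟨fun i hi => ?_, fun i hi j hj hij => (hE.2 hi hj hij).mono ?_ ?_⟩
    · have := hmem i hi
      rw [uIcc_of_le hab]
      exact ⟨⟨le_min this.1.1 hab, min_le_right _ _⟩, ⟨le_min this.2.1 hab, min_le_right _ _⟩⟩
    all_goals
      intro r hr
      simp only [mem_uIoc] at hr ⊢
      grind
  have hE₂ : (E.1, fun i => (max (E.2 i).1 b, max (E.2 i).2 b)) ∈ disjWithin b c := by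
    refine ⟨fun i hi => ?_, fun i hi j hj hij => (hE.2 hi hj hij).mono ?_ ?_⟩
    · have := hmem i hi
      rw [uIcc_of_le hbc]
      exact ⟨⟨le_max_right _ _, max_le this.1.2 hbc⟩, ⟨le_max_right _ _, max_le this.2.2 hbc⟩⟩
    all_goals
      intro r hr
      simp only [mem_uIoc] at hr ⊢
      grind
  have L₁ := H₁ _ hE₁ ((Finset.sum_le_sum fun i _ => (hlen _ _).1).trans_lt
    (hEδ.trans_le (min_le_left _ _)))
  have L₂ := H₂ _ hE₂ ((Finset.sum_le_sum fun i _ => (hlen _ _).2).trans_lt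
    (hEδ.trans_le (min_le_right _ _)))
  have hsum : ∑ i ∈ Finset.range E.1, dist (f (E.2 i).1) (f (E.2 i).2) ≤
      ∑ i ∈ Finset.range E.1, dist (f (min (E.2 i).1 b)) (f (min (E.2 i).2 b)) +
      ∑ i ∈ Finset.range E.1, dist (f (max (E.2 i).1 b)) (f (max (E.2 i).2 b)) := by
    rw [← Finset.sum_add_distrib]
    refine Finset.sum_le_sum fun i _ => ?_
    rcases le_total (E.2 i).1 b with hu | hu <;> rcases le_total (E.2 i).2 b with hv | hv <;>
      simp only [min_eq_left hu, min_eq_right hu, max_eq_left hu, max_eq_right hu, min_eq_left hv,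
        min_eq_right hv, max_eq_left hv, max_eq_right hv, dist_self, add_zero, zero_add, le_refl]
    · exact dist_triangle _ _ _
    · rw [add_comm]; exact dist_triangle _ _ _
  linarith

end AbsolutelyContinuous

/-! ### Admissible curves and additivity of the action -/

section Action

variable {N : ℕ} {L : Torus N → ℝ → Vel N → ℝ} {ζ η : ℝ → Torus N} {a b c : ℝ}

/-- The curves with finite action. -/
def IsAdmissible (L : Torus N → ℝ → Vel N → ℝ) (ζ : ℝ → Torus N) (a b : ℝ) : Prop :=
  AbsolutelyContinuousOnInterval ζ a b ∧
    IntervalIntegrable (fun t => L (ζ t) t (velocity ζ t)) volume a b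

/-- The action of an admissible curve, as a real number. -/
def actionIntegral (L : Torus N → ℝ → Vel N → ℝ) (ζ : ℝ → Torus N) (a b : ℝ) : ℝ :=
  ∫ t in a..b, L (ζ t) t (velocity ζ t)

theorem action_of_isAdmissible (h : IsAdmissible L ζ a b) :
    action L ζ a b = (actionIntegral L ζ a b : EReal) := if_pos h

theorem action_of_not_isAdmissible (h : ¬ IsAdmissible L ζ a b) : action L ζ a b = ⊤ := if_neg h

/-- The velocity depends on the germ of the curve, so agreement on `[a, b]` decides it only at
interior times; the end point `b` is discarded as a null set. -/
theorem ae_lagrangian_congr (L : Torus N → ℝ → Vel N → ℝ) (hab : a ≤ b) (h : EqOn ζ η (Icc a b)) :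
    ∀ᵐ t, t ∈ uIoc a b → L (ζ t) t (velocity ζ t) = L (η t) t (velocity η t) := by
  have hb : ∀ᵐ t : ℝ, t ≠ b := by simp [ae_iff, measure_singleton]
  filter_upwards [hb] with t htb ht
  rw [uIoc_of_le hab] at ht
  have ht' : t ∈ Ioo a b := ⟨ht.1, lt_of_le_of_ne ht.2 htb⟩
  rw [h (Ioc_subset_Icc_self ht),
    velocity_congr ((h.mono Ioo_subset_Icc_self).eventuallyEq_of_mem (Ioo_mem_nhds ht'.1 ht'.2))]

theorem IsAdmissible.congr (hζ : IsAdmissible L ζ a b) (hab : a ≤ b) (h : EqOn ζ η (Icc a b)) :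
    IsAdmissible L η a b :=
  ⟨hζ.1.congr (by rwa [uIcc_of_le hab]), hζ.2.congr_ae <|
    (ae_restrict_iff' measurableSet_uIoc).2 (ae_lagrangian_congr L hab h)⟩

theorem actionIntegral_congr (hab : a ≤ b) (h : EqOn ζ η (Icc a b)) :
    actionIntegral L ζ a b = actionIntegral L η a b :=
  intervalIntegral.integral_congr_ae (ae_lagrangian_congr L hab h)

theorem IsAdmissible.mono (hζ : IsAdmissible L ζ a b) {c d : ℝ} (h : uIcc c d ⊆ uIcc a b) :
    IsAdmissible L ζ c d :=
  ⟨hζ.1.mono h, hζ.2.mono_set h⟩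

theorem IsAdmissible.trans (hab : a ≤ b) (hbc : b ≤ c) (h₁ : IsAdmissible L ζ a b)
    (h₂ : IsAdmissible L ζ b c) : IsAdmissible L ζ a c :=
  ⟨h₁.1.trans hab hbc h₂.1, h₁.2.trans h₂.2⟩

theorem actionIntegral_add (h₁ : IsAdmissible L ζ a b) (h₂ : IsAdmissible L ζ b c) :
    actionIntegral L ζ a b + actionIntegral L ζ b c = actionIntegral L ζ a c :=
  intervalIntegral.integral_add_adjacent_intervals h₁.2 h₂.2

/-- The concatenation at time `b` of two curves. -/
def concat (ζ η : ℝ → Torus N) (b s : ℝ) : Torus N := if s ≤ b then ζ s else η s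

theorem eqOn_concat_left (ζ η : ℝ → Torus N) : EqOn ζ (concat ζ η b) (Icc a b) :=
  fun _ hs => (if_pos hs.2).symm

theorem eqOn_concat_right (h : ζ b = η b) : EqOn η (concat ζ η b) (Icc b c) := fun s hs => by
  rcases hs.1.eq_or_lt with rfl | hlt
  · simp [concat, h]
  · exact (if_neg hlt.not_ge).symm

theorem isAdmissible_concat (hab : a ≤ b) (hbc : b ≤ c) (hζ : IsAdmissible L ζ a b)
    (hη : IsAdmissible L η b c) (h : ζ b = η b) : IsAdmissible L (concat ζ η b) a c :=
  (hζ.congr hab (eqOn_concat_left ζ η)).trans hab hbc (hη.congr hbc (eqOn_concat_right h))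

theorem actionIntegral_concat (hab : a ≤ b) (hbc : b ≤ c) (hζ : IsAdmissible L ζ a b)
    (hη : IsAdmissible L η b c) (h : ζ b = η b) :
    actionIntegral L (concat ζ η b) a c = actionIntegral L ζ a b + actionIntegral L η b c := by
  rw [← actionIntegral_add (hζ.congr hab (eqOn_concat_left ζ η))
    (hη.congr hbc (eqOn_concat_right h)), ← actionIntegral_congr hab (eqOn_concat_left ζ η),
    ← actionIntegral_congr hbc (eqOn_concat_right h)]

theorem IsTonelli.continuousOn_segment {T : ℝ} (hL : IsTonelli T L) (x : Torus N) (t : ℝ)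
    (q : Vel N) : ContinuousOn (fun s => L (segment x t q s) s q) (Icc 0 T) :=
  ContinuousOn.comp (f := fun s => (segment x t q s, s, q)) hL.continuousOn
    (by have := continuous_segment x t q; fun_prop) fun _ hs => ⟨mem_univ _, hs, mem_univ _⟩

theorem IsTonelli.isAdmissible_segment {T : ℝ} (hL : IsTonelli T L) (x : Torus N) (t : ℝ)
    (q : Vel N) (h : uIcc a b ⊆ Icc 0 T) : IsAdmissible L (segment x t q) a b := by
  refine ⟨(lipschitzWith_segment x t q).lipschitzOnWith.absolutelyContinuousOnInterval, ?_⟩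
  simp only [velocity_segment]
  exact ((hL.continuousOn_segment x t q).mono h).intervalIntegrable

theorem actionIntegral_segment (x : Torus N) (t : ℝ) (q : Vel N) :
    actionIntegral L (segment x t q) a b = ∫ s in a..b, L (segment x t q s) s q := by
  simp only [actionIntegral, velocity_segment]

end Action

/-! ### Finiteness of the value function and dynamic programming -/

section ValueFunction

variable {N : ℕ} {T : ℝ} {H₀ : Torus N → ℝ → Vel N → ℝ} {g₀ : Torus N → ℝ}

theorem IsTonelli.exists_le_actionIntegral {L : Torus N → ℝ → Vel N → ℝ}
    (hL : IsTonelli T L) : ∃ C : ℝ, ∀ (ζ : ℝ → Torus N) (a b : ℝ), 0 ≤ a → a ≤ b → b ≤ T →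
      IsAdmissible L ζ a b → -C ≤ actionIntegral L ζ a b := by
  obtain ⟨C, hC0, hC⟩ := hL.coercive
  refine ⟨C * T, fun ζ a b ha hab hb hζ => ?_⟩
  have h := intervalIntegral.integral_mono_on hab (f := fun _ => -C) (by simp) hζ.2 fun t ht => by
    have := hC (ζ t) t ⟨ha.trans ht.1, ht.2.trans hb⟩ (velocity ζ t)
    linarith [norm_nonneg (velocity ζ t)]
  rw [intervalIntegral.integral_const, smul_eq_mul] at h
  refine le_trans ?_ h
  nlinarith

theorem IsTonelli.exists_actionIntegral_const_le {L : Torus N → ℝ → Vel N → ℝ} (hT : 0 ≤ T)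
    (hL : IsTonelli T L) : ∃ C : ℝ, ∀ x : Torus N,
      actionIntegral L (segment x 0 0) 0 T ≤ C := by
  have hK : IsCompact ((univ : Set (Torus N)) ×ˢ Icc 0 T ×ˢ ({0} : Set (Vel N))) :=
    isCompact_univ.prod (isCompact_Icc.prod isCompact_singleton)
  obtain ⟨M, hM⟩ := hK.exists_bound_of_continuousOn
    (hL.continuousOn.mono (prod_mono_right (prod_mono_right (subset_univ _))))
  refine ⟨M * T, fun x => ?_⟩
  rw [actionIntegral_segment]
  have h := intervalIntegral.integral_mono_on hT
    (μ := volume) (f := fun s => L (segment x 0 0 s) s 0) (g := fun _ => M)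
    ((hL.continuousOn_segment x 0 0).mono (uIcc_of_le hT).subset).intervalIntegrable
    intervalIntegrable_const fun s hs => (le_abs_self _).trans (hM (segment x 0 0 s, s, 0) ⟨mem_univ _, hs, rfl⟩)
  simpa [mul_comm] using h

/-- The infimum in the Lax–Oleinik formula is a real number. -/
theorem iInf_cost_eq (hL : IsTonelli T (lagrangian H₀)) (hg₀ : Continuous g₀)
    (x : Torus N) {t : ℝ} (ht : t ∈ Icc 0 T) :
    (⨅ (ζ : ℝ → Torus N) (_ : ζ t = x),
      ((g₀ (ζ T) : ℝ) : EReal) + action (lagrangian H₀) ζ t T) = (valueFun T H₀ g₀ x t : EReal) := by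
  obtain ⟨C, hC⟩ := hL.exists_le_actionIntegral
  obtain ⟨G, hG⟩ := isCompact_univ.exists_bound_of_continuousOn (hg₀.continuousOn (s := univ))
  refine (EReal.coe_toReal ?_ ?_).symm
  · refine ne_top_of_le_ne_top ?_ (iInf₂_le (segment x t 0) (segment_self x t 0))
    rw [action_of_isAdmissible (hL.isAdmissible_segment x t 0 (by
      rw [uIcc_of_le ht.2]; exact Icc_subset_Icc_left ht.1)), ← EReal.coe_add]
    exact EReal.coe_ne_top _
  · refine ne_bot_of_le_ne_bot (b := ((-G + -C : ℝ) : EReal)) (EReal.coe_ne_bot _)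
      (le_iInf₂ fun ζ _ => ?_)
    by_cases hζ : IsAdmissible (lagrangian H₀) ζ t T
    · rw [action_of_isAdmissible hζ, ← EReal.coe_add, EReal.coe_le_coe_iff]
      exact add_le_add (neg_le_of_abs_le (hG _ (mem_univ _))) (hC ζ t T ht.1 ht.2 le_rfl hζ)
    · rw [action_of_not_isAdmissible hζ, EReal.coe_add_top]
      exact le_top

theorem valueFun_le (hL : IsTonelli T (lagrangian H₀)) (hg₀ : Continuous g₀)
    {ζ : ℝ → Torus N} {t : ℝ} (ht : t ∈ Icc 0 T) (hζ : IsAdmissible (lagrangian H₀) ζ t T) :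
    valueFun T H₀ g₀ (ζ t) t ≤ g₀ (ζ T) + actionIntegral (lagrangian H₀) ζ t T := by
  rw [← EReal.coe_le_coe_iff, ← iInf_cost_eq hL hg₀ _ ht, EReal.coe_add,
    ← action_of_isAdmissible hζ]
  exact iInf_le_of_le ζ (iInf_le _ rfl)

theorem exists_lt_valueFun_add (hL : IsTonelli T (lagrangian H₀))
    (hg₀ : Continuous g₀) (x : Torus N) {t : ℝ} (ht : t ∈ Icc 0 T) {ε : ℝ} (hε : 0 < ε) :
    ∃ ζ : ℝ → Torus N, ζ t = x ∧ IsAdmissible (lagrangian H₀) ζ t T ∧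
      g₀ (ζ T) + actionIntegral (lagrangian H₀) ζ t T < valueFun T H₀ g₀ x t + ε := by
  have h : (⨅ (ζ : ℝ → Torus N) (_ : ζ t = x),
      ((g₀ (ζ T) : ℝ) : EReal) + action (lagrangian H₀) ζ t T) <
        ((valueFun T H₀ g₀ x t + ε : ℝ) : EReal) := by
    rw [iInf_cost_eq hL hg₀ x ht, EReal.coe_lt_coe_iff]
    linarith
  simp only [iInf_lt_iff] at h
  obtain ⟨ζ, hx, hlt⟩ := h
  by_cases hζ : IsAdmissible (lagrangian H₀) ζ t T
  · rw [action_of_isAdmissible hζ, ← EReal.coe_add, EReal.coe_lt_coe_iff] at hlt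
    exact ⟨ζ, hx, hζ, hlt⟩
  · rw [action_of_not_isAdmissible hζ, EReal.coe_add_top] at hlt
    exact absurd hlt not_top_lt

/-- The dynamic programming inequality. -/
theorem valueFun_le_add (hL : IsTonelli T (lagrangian H₀)) (hg₀ : Continuous g₀)
    {ζ : ℝ → Torus N} {t s : ℝ} (ht : 0 ≤ t) (hts : t ≤ s) (hs : s ≤ T)
    (hζ : IsAdmissible (lagrangian H₀) ζ t s) :
    valueFun T H₀ g₀ (ζ t) t ≤
      actionIntegral (lagrangian H₀) ζ t s + valueFun T H₀ g₀ (ζ s) s := by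
  -- Existence of minimizers is not needed: an `ε`-optimal continuation is glued on at time `s`.
  refine le_of_forall_pos_lt_add fun ε hε => ?_
  obtain ⟨η, hx, hη, hlt⟩ := exists_lt_valueFun_add hL hg₀ (ζ s) ⟨ht.trans hts, hs⟩ hε
  have h := valueFun_le hL hg₀ ⟨ht, hts.trans hs⟩ (isAdmissible_concat hts hs hζ hη hx.symm)
  rw [actionIntegral_concat hts hs hζ hη hx.symm,
    ← eqOn_concat_left ζ η (left_mem_Icc.2 hts),
    ← eqOn_concat_right hx.symm (right_mem_Icc.2 hs)] at h
  linarith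

theorem valueFun_le_segment (hL : IsTonelli T (lagrangian H₀)) (hg₀ : Continuous g₀)
    (x : Torus N) (q : Vel N) {t s : ℝ} (ht : 0 ≤ t) (hts : t ≤ s) (hs : s ≤ T) :
    valueFun T H₀ g₀ x t ≤ (∫ r in t..s, lagrangian H₀ (segment x t q r) r q) +
      valueFun T H₀ g₀ (x + proj ((s - t) • q)) s := by
  have h := valueFun_le_add hL hg₀ ht hts hs (hL.isAdmissible_segment x t q
    (by rw [uIcc_of_le hts]; exact Icc_subset_Icc ht hs))
  rwa [segment_self, actionIntegral_segment] at h

end ValueFunction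

/-! ### Optimal curves -/

section Optimal

variable {N : ℕ} {T : ℝ} {H₀ : Torus N → ℝ → Vel N → ℝ} {g₀ : Torus N → ℝ}

theorem CurveSpace.continuous_ext (hT : 0 ≤ T) (ζ : CurveSpace N T) : Continuous (ζ.ext hT) :=
  ζ.continuous.Icc_extend'

theorem CurveSpace.exists_ext_eqOn (hT : 0 ≤ T) {ζ : ℝ → Torus N} (hζ : ContinuousOn ζ (Icc 0 T)) :
    ∃ η : CurveSpace N T, EqOn ζ (η.ext hT) (Icc 0 T) :=
  ⟨⟨fun t => ζ t, hζ.domRestrict⟩, fun t ht => by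
    rw [CurveSpace.ext, IccExtend_of_mem hT _ ht]; rfl⟩

theorem totalCost_of_eqOn (hT : 0 ≤ T) {ζ : ℝ → Torus N}
    (hζ : IsAdmissible (lagrangian H₀) ζ 0 T) {η : CurveSpace N T}
    (h : EqOn ζ (η.ext hT) (Icc 0 T)) :
    totalCost hT H₀ g₀ η = ((g₀ (ζ T) + actionIntegral (lagrangian H₀) ζ 0 T : ℝ) : EReal) := by
  rw [totalCost, action_of_isAdmissible (hζ.congr hT h), ← h (right_mem_Icc.2 hT),
    ← actionIntegral_congr hT h, EReal.coe_add]

theorem IsOptimalCurve.isAdmissible {hT : 0 ≤ T} (hL : IsTonelli T (lagrangian H₀))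
    {ζ : CurveSpace N T} (hζ : IsOptimalCurve hT H₀ g₀ ζ) :
    IsAdmissible (lagrangian H₀) (ζ.ext hT) 0 T := by
  by_contra hn
  obtain ⟨η, hη⟩ := CurveSpace.exists_ext_eqOn hT
    (continuous_segment (ζ.ext hT 0) 0 0).continuousOn
  have h := hζ η (by rw [← hη (left_mem_Icc.2 hT), segment_self])
  rw [totalCost_of_eqOn hT (hL.isAdmissible_segment _ 0 0 (uIcc_of_le hT).subset) hη, totalCost,
    action_of_not_isAdmissible hn, EReal.coe_add_top, top_le_iff] at h
  exact EReal.coe_ne_top _ h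

theorem IsOptimalCurve.cost_le {hT : 0 ≤ T} (hL : IsTonelli T (lagrangian H₀))
    {ζ : CurveSpace N T} (hζ : IsOptimalCurve hT H₀ g₀ ζ) {η : ℝ → Torus N} (h0 : η 0 = ζ.ext hT 0)
    (hη : IsAdmissible (lagrangian H₀) η 0 T) :
    g₀ (ζ.ext hT T) + actionIntegral (lagrangian H₀) (ζ.ext hT) 0 T ≤
      g₀ (η T) + actionIntegral (lagrangian H₀) η 0 T := by
  obtain ⟨η', hη'⟩ := CurveSpace.exists_ext_eqOn hT
    (hη.1.continuousOn.mono (uIcc_of_le hT).symm.subset)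
  have h := hζ η' (by rw [← hη' (left_mem_Icc.2 hT), h0])
  rwa [totalCost_of_eqOn hT hη hη', totalCost_of_eqOn hT (hζ.isAdmissible hL) (eqOn_refl _ _),
    EReal.coe_le_coe_iff] at h

/-- Along an optimal curve the value function is the cost of the rest of the curve. -/
theorem IsOptimalCurve.valueFun_eq {hT : 0 ≤ T} (hL : IsTonelli T (lagrangian H₀))
    (hg₀ : Continuous g₀) {ζ : CurveSpace N T} (hζ : IsOptimalCurve hT H₀ g₀ ζ) {t : ℝ}
    (ht : t ∈ Icc 0 T) :
    valueFun T H₀ g₀ (ζ.ext hT t) t =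
      g₀ (ζ.ext hT T) + actionIntegral (lagrangian H₀) (ζ.ext hT) t T := by
  have hadm := hζ.isAdmissible hL
  have h₁ : IsAdmissible (lagrangian H₀) (ζ.ext hT) 0 t := hadm.mono (by
    rw [uIcc_of_le hT, uIcc_of_le ht.1]; exact Icc_subset_Icc_right ht.2)
  have h₂ : IsAdmissible (lagrangian H₀) (ζ.ext hT) t T := hadm.mono (by
    rw [uIcc_of_le hT, uIcc_of_le ht.2]; exact Icc_subset_Icc_left ht.1)
  refine le_antisymm (valueFun_le hL hg₀ ht h₂) (le_of_forall_pos_lt_add fun ε hε => ?_)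
  obtain ⟨η, hx, hη, hlt⟩ := exists_lt_valueFun_add hL hg₀ (ζ.ext hT t) ht hε
  -- A cheaper continuation from `ζ(t)`, glued to `ζ` on `[0, t]`, would beat `ζ` itself.
  have h := hζ.cost_le hL (η := concat (ζ.ext hT) η t)
    (eqOn_concat_left (ζ.ext hT) η (left_mem_Icc.2 ht.1)).symm
    (isAdmissible_concat ht.1 ht.2 h₁ hη hx.symm)
  rw [actionIntegral_concat ht.1 ht.2 h₁ hη hx.symm,
    ← eqOn_concat_right hx.symm (right_mem_Icc.2 ht.2), ← actionIntegral_add h₁ h₂] at h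
  linarith

/-- The competitor is the constant curve; `2 * G` accounts for the oscillation of `g₀`. The
uniformity in `ζ` makes the later integration over `ξ` possible. -/
theorem exists_actionIntegral_optimal_le (hT : 0 ≤ T) (hL : IsTonelli T (lagrangian H₀))
    (hg₀ : Continuous g₀) : ∃ C : ℝ, ∀ ζ : CurveSpace N T, IsOptimalCurve hT H₀ g₀ ζ →
      actionIntegral (lagrangian H₀) (ζ.ext hT) 0 T ≤ C := by
  obtain ⟨C, hC⟩ := hL.exists_actionIntegral_const_le hT
  obtain ⟨G, hG⟩ := isCompact_univ.exists_bound_of_continuousOn (hg₀.continuousOn (s := univ))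
  refine ⟨2 * G + C, fun ζ hζ => ?_⟩
  have h := hζ.cost_le hL (η := segment (ζ.ext hT 0) 0 0) (segment_self _ _ _)
    (hL.isAdmissible_segment _ 0 0 (uIcc_of_le hT).subset)
  have h1 := neg_le_of_abs_le (hG (ζ.ext hT T) (mem_univ _))
  have h2 := le_of_abs_le (hG (segment (ζ.ext hT 0) 0 0 T) (mem_univ _))
  linarith [hC (ζ.ext hT 0)]

end Optimal

/-! ### Derivatives detected along rational increments -/

section Derivative

variable {f g : ℝ → ℝ} {a : ℝ}

theorem hasDerivAt_zero_iff : HasDerivAt f a 0 ↔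
    ∀ ε > 0, ∃ δ > 0, ∀ h : ℝ, |h| < δ → |f h - f 0 - h * a| ≤ ε * |h| := by
  rw [hasDerivAt_iff_isLittleO, Asymptotics.isLittleO_iff]
  refine forall₂_congr fun ε _ => ?_
  rw [Metric.eventually_nhds_iff]
  simp

theorem le_of_forall_rat_gt {φ : ℝ → ℝ} {c h b : ℝ} (hφ : ContinuousAt φ h) (hb : h < b)
    (H : ∀ r : ℚ, h < r → (r : ℝ) < b → c ≤ φ r) : c ≤ φ h := by
  by_contra! hc
  obtain ⟨δ, hδ, hball⟩ := Metric.eventually_nhds_iff.1 (hφ.eventually_lt continuousAt_const hc)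
  obtain ⟨r, hr₁, hr₂⟩ := exists_rat_btwn (lt_min hb (by linarith : h < h + δ))
  refine (hball ?_).not_ge (H r hr₁ (hr₂.trans_le (min_le_left _ _)))
  rw [Real.dist_eq, abs_of_pos (sub_pos.2 hr₁)]
  linarith [hr₂.trans_le (min_le_right _ _)]

theorem le_of_forall_rat_lt {φ : ℝ → ℝ} {c h b : ℝ} (hφ : ContinuousAt φ h) (hb : b < h)
    (H : ∀ r : ℚ, b < r → (r : ℝ) < h → φ r ≤ c) : φ h ≤ c := by
  have hφ' : ContinuousAt (fun s => -φ (-s)) (-h) :=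
    (ContinuousAt.comp (f := Neg.neg) (x := -h) (by simpa using hφ) continuous_neg.continuousAt).neg
  have := le_of_forall_rat_gt (c := -c) (b := -b) hφ' (by linarith) fun r h₁ h₂ => by
    have := H (-r) (by push_cast; linarith) (by push_cast; linarith)
    push_cast at this
    linarith
  simp only [neg_neg] at this
  linarith

/-- If `f ≤ g` and `g` is below all values of `f` to the right, then `f` has a derivative at `0` exactly
if the difference quotients of `g` converge along the rationals. -/
theorem hasDerivAt_zero_iff_rat {δ₀ : ℝ} (hδ₀ : 0 < δ₀) (hfg : ∀ h, |h| < δ₀ → f h ≤ g h)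
    (hgf : ∀ h h', |h| < δ₀ → |h'| < δ₀ → h < h' → g h ≤ f h') :
    HasDerivAt f a 0 ↔ ∀ n : ℕ, ∃ m : ℕ, ∀ h : ℚ, |(h : ℝ)| < 1 / ((m : ℝ) + 1) →
      |g h - g 0 - h * a| ≤ 1 / ((n : ℝ) + 1) * |(h : ℝ)| := by
  rw [hasDerivAt_zero_iff]
  have hcont : ∀ ε c h : ℝ, ContinuousAt (fun s : ℝ => c + s * a + ε * |s|) h := by
    intro ε c h
    fun_prop
  constructor
  · intro H n
    obtain ⟨δ, hδ, hH⟩ := H (1 / ((n : ℝ) + 1)) Nat.one_div_pos_of_nat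
    set ε := 1 / ((n : ℝ) + 1)
    -- The bound on `f` at rational `r > h` passes to `g h ≤ f r`; then `r` tends to `h`.
    have up : ∀ h : ℝ, |h| < min δ δ₀ → g h ≤ f 0 + h * a + ε * |h| := by
      intro h hh
      refine le_of_forall_rat_gt (φ := fun s => f 0 + s * a + ε * |s|) (hcont ε (f 0) h)
        (lt_of_abs_lt hh) fun r h₁ h₂ => ?_
      have hr : |(r : ℝ)| < min δ δ₀ := abs_lt.2 ⟨(neg_lt_of_abs_lt hh).trans h₁, h₂⟩
      have := le_of_abs_le (hH r (hr.trans_le (min_le_left _ _)))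
      linarith [hgf h r (hh.trans_le (min_le_right _ _)) (hr.trans_le (min_le_right _ _)) h₁]
    have h0 : g 0 = f 0 := le_antisymm
      (by simpa using up 0 (by simpa using ⟨hδ, hδ₀⟩)) (hfg 0 (by simpa using hδ₀))
    obtain ⟨m, hm⟩ := exists_nat_one_div_lt (lt_min hδ hδ₀)
    refine ⟨m, fun h hh => abs_le.2 ⟨?_, ?_⟩⟩
    · have := neg_le_of_abs_le (hH h ((hh.trans hm).trans_le (min_le_left _ _)))
      linarith [hfg h ((hh.trans hm).trans_le (min_le_right _ _))]
    · linarith [up h (hh.trans hm)]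
  · intro H ε hε
    obtain ⟨n, hn⟩ := exists_nat_one_div_lt hε
    obtain ⟨m, hm⟩ := H n
    set ε' := 1 / ((n : ℝ) + 1)
    set δ := min (1 / ((m : ℝ) + 1)) δ₀
    have hδ : 0 < δ := lt_min Nat.one_div_pos_of_nat hδ₀
    have up : ∀ h : ℝ, |h| < δ → f h ≤ g 0 + h * a + ε' * |h| := by
      intro h hh
      refine le_of_forall_rat_gt (φ := fun s => g 0 + s * a + ε' * |s|) (hcont ε' (g 0) h)
        (lt_of_abs_lt hh) fun r h₁ h₂ => ?_
      have hr : |(r : ℝ)| < δ := abs_lt.2 ⟨(neg_lt_of_abs_lt hh).trans h₁, h₂⟩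
      have h3 := le_of_abs_le (hm r (hr.trans_le (min_le_left _ _)))
      have hh' := hh.trans_le (min_le_right _ _)
      have hr' := hr.trans_le (min_le_right _ _)
      linarith [hfg h hh', hgf h r hh' hr' h₁, hfg r hr']
    -- The lower bound comes from rational `r < h`, through `g r ≤ f h`.
    have lo : ∀ h : ℝ, |h| < δ → g 0 + h * a + -ε' * |h| ≤ f h := by
      intro h hh
      refine le_of_forall_rat_lt (φ := fun s => g 0 + s * a + -ε' * |s|) (hcont (-ε') (g 0) h)
        (neg_lt_of_abs_lt hh) fun r h₁ h₂ => ?_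
      have hr : |(r : ℝ)| < δ := abs_lt.2 ⟨h₁, h₂.trans (lt_of_abs_lt hh)⟩
      have h3 := neg_le_of_abs_le (hm r (hr.trans_le (min_le_left _ _)))
      linarith [hgf r h (hr.trans_le (min_le_right _ _)) (hh.trans_le (min_le_right _ _)) h₂]
    have h0 : f 0 = g 0 := le_antisymm (by simpa using up 0 (by simpa using hδ))
      (by simpa using lo 0 (by simpa using hδ))
    refine ⟨δ, hδ, fun h hh => (?_ : _ ≤ ε' * |h|).trans (by gcongr)⟩
    rw [h0, abs_le]
    constructor <;> linarith [up h hh, lo h hh]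

end Derivative

/-! ### Uniqueness of the optimal velocity -/

section Field

variable {N : ℕ} {T : ℝ} {H₀ : Torus N → ℝ → Vel N → ℝ} {g₀ : Torus N → ℝ}

theorem IsTonelli.exists_lt_of_near {L : Torus N → ℝ → Vel N → ℝ} (hL : IsTonelli T L)
    (x : Torus N) {t : ℝ} (ht : t ∈ Icc 0 T) (q : Vel N) {ε : ℝ} (hε : 0 < ε) :
    ∃ δ > 0, ∀ y s p, s ∈ Icc 0 T → dist y x < δ → |s - t| < δ → dist p q < δ →
      L y s p < L x t q + ε := by
  have h := hL.continuousOn (x, t, q) ⟨mem_univ _, ht, mem_univ _⟩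
  rw [Metric.continuousWithinAt_iff] at h
  obtain ⟨δ, hδ, H⟩ := h ε hε
  refine ⟨δ, hδ, fun y s p hs hy hst hp => ?_⟩
  have := H (x := (y, s, p)) ⟨mem_univ _, hs, mem_univ _⟩
    (by rw [Prod.dist_eq, Prod.dist_eq]; exact max_lt hy (max_lt hst hp))
  rw [Real.dist_eq] at this
  linarith [lt_of_abs_lt this]

/-- Near `(x, t)`, moving with a velocity close to `q` costs at most about `L(x, t, q)` per unit of
time. -/
theorem valueFun_le_of_near (hL : IsTonelli T (lagrangian H₀)) (hg₀ : Continuous g₀)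
    (x : Torus N) {t : ℝ} (ht : t ∈ Ioo 0 T) (q : Vel N) {ε : ℝ} (hε : 0 < ε) :
    ∃ δ > 0, ∀ y r s p, dist y x < δ → t - δ < r → r ≤ s → s < t + δ → dist p q < δ →
      valueFun T H₀ g₀ y r ≤ (s - r) * (lagrangian H₀ x t q + ε) +
        valueFun T H₀ g₀ (y + proj ((s - r) • p)) s := by
  obtain ⟨δ, hδ, H⟩ := hL.exists_lt_of_near x (Ioo_subset_Icc_self ht) q hε
  have hQ : 0 < ‖q‖ + 1 := by positivity
  -- With speed at most `‖q‖ + 1` and duration at most twice this radius, the segment moves by at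
  -- most `δ / 2` and stays `δ`-close to `x`; the last two terms keep the times in `[0, T]`.
  refine ⟨min (min 1 (δ / 2)) (min (δ / 2 / (2 * (‖q‖ + 1))) (min t (T - t))),
    lt_min (lt_min one_pos (half_pos hδ)) (lt_min (by positivity) (lt_min ht.1 (sub_pos.2 ht.2))),
    fun y r s p hy hr hrs hs hp => ?_⟩
  set η := min (min 1 (δ / 2)) (min (δ / 2 / (2 * (‖q‖ + 1))) (min t (T - t)))
  have e1 : η ≤ 1 := (min_le_left _ _).trans (min_le_left _ _)
  have e2 : η ≤ δ / 2 := (min_le_left _ _).trans (min_le_right _ _)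
  have e3 : η ≤ δ / 2 / (2 * (‖q‖ + 1)) := (min_le_right _ _).trans (min_le_left _ _)
  have e4 : η ≤ t := (min_le_right _ _).trans ((min_le_right _ _).trans (min_le_left _ _))
  have e5 : η ≤ T - t := (min_le_right _ _).trans ((min_le_right _ _).trans (min_le_right _ _))
  rw [le_div_iff₀ (by positivity)] at e3
  have hpn : ‖p‖ ≤ ‖q‖ + 1 := by
    have := norm_le_norm_add_norm_sub' p q
    rw [← dist_eq_norm] at this
    linarith
  refine (valueFun_le_segment hL hg₀ y p (by linarith) hrs (by linarith)).trans ?_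
  gcongr
  have hsub : uIcc r s ⊆ Icc 0 T := by
    rw [uIcc_of_le hrs]; exact Icc_subset_Icc (by linarith) (by linarith)
  have h := intervalIntegral.integral_mono_on hrs (μ := volume)
    (f := fun σ => lagrangian H₀ (segment y r p σ) σ p)
    (g := fun _ => lagrangian H₀ x t q + ε)
    ((hL.continuousOn_segment y r p).mono hsub).intervalIntegrable intervalIntegrable_const
    fun σ hσ => (H _ _ _ (hsub (by rwa [uIcc_of_le hrs])) ?_ ?_ (by linarith)).le
  · rwa [intervalIntegral.integral_const, smul_eq_mul] at h
  · have h1 := (lipschitzWith_segment y r p).dist_le_mul σ r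
    rw [segment_self, Real.dist_eq, abs_of_nonneg (sub_nonneg.2 hσ.1), coe_nnnorm] at h1
    have h2 : ‖p‖ * (σ - r) ≤ (‖q‖ + 1) * (2 * η) := by
      have := hσ.2
      exact mul_le_mul hpn (by linarith) (sub_nonneg.2 hσ.1) hQ.le
    linarith [dist_triangle (segment y r p σ) y x]
  · rw [abs_lt]
    constructor <;> linarith [hσ.1, hσ.2]

theorem mem_fieldSet {x : Torus N} {t : ℝ} {q : Vel N} : q ∈ fieldSet T H₀ g₀ x t ↔
    HasDerivAt (fun h : ℝ => valueFun T H₀ g₀ (x + proj (h • q)) (t + h))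
      (-lagrangian H₀ x t q) 0 := Iff.rfl

/-- Arriving with `q₁` and leaving with `q₂` makes a corner at `x`. Cutting it by a straight segment
of velocity `(q₁ + q₂) / 2` would save cost to first order in `h` if `q₁ ≠ q₂`. -/
theorem fieldSet_subsingleton (hL : IsTonelli T (lagrangian H₀)) (hg₀ : Continuous g₀)
    (x : Torus N) {t : ℝ} (ht : t ∈ Ioo 0 T) : (fieldSet T H₀ g₀ x t).Subsingleton := by
  intro q₁ h₁ q₂ h₂
  rw [mem_fieldSet, hasDerivAt_zero_iff] at h₁ h₂
  refine hL.eq_of_midpoint_le x t (Ioo_subset_Icc_self ht) q₁ q₂ (le_of_forall_pos_le_add ?_)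
  intro ε' hε'
  obtain ⟨ε, hε, rfl⟩ : ∃ ε > 0, ε' = 4 * ε := ⟨ε' / 4, by positivity, by ring⟩
  obtain ⟨δ₁, hδ₁, H₁⟩ := h₁ ε hε
  obtain ⟨δ₂, hδ₂, H₂⟩ := h₂ ε hε
  obtain ⟨δ, hδ, H⟩ := valueFun_le_of_near hL hg₀ x ht ((2 : ℝ)⁻¹ • (q₁ + q₂)) hε
  have hq : 0 < ‖q₁‖ + 1 := by positivity
  obtain ⟨h, h0, hh⟩ := exists_between (lt_min (lt_min hδ₁ hδ₂)
    (lt_min hδ (by positivity : 0 < δ / (‖q₁‖ + 1))))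
  have b1 := hh.trans_le ((min_le_left _ _).trans (min_le_left _ _))
  have b2 := hh.trans_le ((min_le_left _ _).trans (min_le_right _ _))
  have b3 := hh.trans_le ((min_le_right _ _).trans (min_le_left _ _))
  have b4 := hh.trans_le ((min_le_right _ _).trans (min_le_right _ _))
  rw [lt_div_iff₀ hq] at b4
  have k1 := neg_le_of_abs_le (H₁ (-h) (by rwa [abs_neg, abs_of_pos h0]))
  have k2 := le_of_abs_le (H₂ h (by rwa [abs_of_pos h0]))
  have k3 := H (x + proj (-h • q₁)) (t + -h) (t + h) ((2 : ℝ)⁻¹ • (q₁ + q₂)) (by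
    rw [dist_eq_norm, add_sub_cancel_left]
    refine (norm_proj_le _).trans_lt ?_
    rw [norm_smul, norm_neg, Real.norm_of_nonneg h0.le]
    nlinarith) (by linarith) (by linarith) (by linarith) (by simpa using hδ)
  have e : x + proj (-h • q₁) + proj ((t + h - (t + -h)) • (2 : ℝ)⁻¹ • (q₁ + q₂)) =
      x + proj (h • q₂) := by
    rw [add_assoc, ← proj_add]
    congr 2
    module
  rw [e] at k3
  simp only [zero_smul, proj_zero, add_zero, abs_neg, abs_of_pos h0] at k1 k2
  refine le_of_mul_le_mul_left ?_ h0
  linarith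

end Field

/-! ### Functions monotone along a cone, and their Borel envelope -/

section ConeMonotone

variable {N : ℕ} {T R : ℝ} {U : Torus N → ℝ → ℝ}

/-- `U` does not decrease along motions with speed at most `R`. -/
def ConeMonotone (T R : ℝ) (U : Torus N → ℝ → ℝ) : Prop :=
  ∀ (x : Torus N) (q : Vel N) (t s : ℝ), ‖q‖ ≤ R → 0 ≤ t → t ≤ s → s ≤ T →
    U x t ≤ U (x + proj ((s - t) • q)) s

open Classical in
/-- The infimum of `U` over the points of space-time that are reached from `z` in positive time with
speed less than `R`. -/
def coneEnvelope (T R : ℝ) (U : Torus N → ℝ → ℝ) (z : Torus N × ℝ) : ℝ :=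
  if z.2 ∈ Ioo 0 T then
    sInf {u | ∃ y s, z.2 < s ∧ s < T ∧ dist z.1 y < R * (s - z.2) ∧ U y s = u}
  else 0

theorem ConeMonotone.le_of_dist_le (hU : ConeMonotone T R U) {x y : Torus N} {t s : ℝ} (ht : 0 ≤ t)
    (hts : t < s) (hs : s ≤ T) (hd : dist x y ≤ R * (s - t)) : U x t ≤ U y s := by
  obtain ⟨a, ha, hn⟩ := exists_proj_eq_norm_eq (y - x)
  have hst : 0 < s - t := sub_pos.2 hts
  have h := hU x ((s - t)⁻¹ • a) t s ?_ ht hts.le hs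
  · rwa [smul_inv_smul₀ hst.ne', ha, add_sub_cancel] at h
  · rw [norm_smul, norm_inv, Real.norm_of_nonneg hst.le, hn, ← dist_eq_norm, dist_comm,
      inv_mul_le_iff₀ hst]
    linarith

theorem coneEnvelope_set_nonempty (hR : 0 < R) {x : Torus N} {t : ℝ} (ht : t ∈ Ioo 0 T) :
    {u | ∃ y s, t < s ∧ s < T ∧ dist x y < R * (s - t) ∧ U y s = u}.Nonempty := by
  obtain ⟨s, h₁, h₂⟩ := exists_between ht.2
  exact ⟨_, x, s, h₁, h₂, by rw [dist_self]; exact mul_pos hR (sub_pos.2 h₁), rfl⟩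

theorem ConeMonotone.mem_lowerBounds (hU : ConeMonotone T R U) {x : Torus N} {t : ℝ}
    (ht : t ∈ Ioo 0 T) :
    U x t ∈ lowerBounds {u | ∃ y s, t < s ∧ s < T ∧ dist x y < R * (s - t) ∧ U y s = u} := by
  rintro _ ⟨y, s, h₁, h₂, h₃, rfl⟩
  exact hU.le_of_dist_le ht.1.le h₁ h₂.le h₃.le

theorem ConeMonotone.le_coneEnvelope (hU : ConeMonotone T R U) (hR : 0 < R) {x : Torus N} {t : ℝ}
    (ht : t ∈ Ioo 0 T) : U x t ≤ coneEnvelope T R U (x, t) := by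
  rw [coneEnvelope, if_pos ht]
  exact le_csInf (coneEnvelope_set_nonempty hR ht) (hU.mem_lowerBounds ht)

theorem ConeMonotone.coneEnvelope_le (hU : ConeMonotone T R U) {x y : Torus N} {t s : ℝ}
    (ht : t ∈ Ioo 0 T) (hts : t < s) (hs : s < T) (hd : dist x y < R * (s - t)) :
    coneEnvelope T R U (x, t) ≤ U y s := by
  rw [coneEnvelope, if_pos ht]
  exact csInf_le ⟨_, hU.mem_lowerBounds ht⟩ ⟨y, s, hts, hs, hd, rfl⟩

/-- Since the cone is open, the condition that some admissible `(y, s)` has `U y s < a` is open in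
the base point. So the envelope is upper semicontinuous on the strip, whatever the regularity of
`U`. -/
theorem ConeMonotone.measurable_coneEnvelope (hU : ConeMonotone T R U) (hR : 0 < R) :
    Measurable (coneEnvelope T R U) := by
  refine measurable_of_Iio fun a => ?_
  have hstrip : MeasurableSet {z : Torus N × ℝ | z.2 ∈ Ioo 0 T} :=
    measurable_snd measurableSet_Ioo
  have hopen : IsOpen {z : Torus N × ℝ |
      ∃ y s, s < T ∧ U y s < a ∧ z.2 < s ∧ dist z.1 y < R * (s - z.2)} := by
    simp only [ofPred_exists, ofPred_and]
    refine isOpen_iUnion fun y => isOpen_iUnion fun s => isOpen_const.inter (isOpen_const.inter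
      (IsOpen.inter ?_ ?_))
    · exact isOpen_lt continuous_snd continuous_const
    · exact isOpen_lt (by fun_prop) (by fun_prop)
  have hset : coneEnvelope T R U ⁻¹' Iio a =
      ({z : Torus N × ℝ | z.2 ∈ Ioo 0 T} ∩ {z : Torus N × ℝ |
        ∃ y s, s < T ∧ U y s < a ∧ z.2 < s ∧ dist z.1 y < R * (s - z.2)}) ∪
      ({z : Torus N × ℝ | z.2 ∈ Ioo 0 T}ᶜ ∩ {_z : Torus N × ℝ | 0 < a}) := by
    ext ⟨x, t⟩
    by_cases ht : t ∈ Ioo 0 T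
    · simp only [mem_preimage, mem_Iio, mem_union, mem_inter_iff, mem_ofPred_eq, mem_compl_iff, ht,
        true_and, not_true, false_and, or_false]
      constructor
      · intro h
        rw [coneEnvelope, if_pos ht] at h
        obtain ⟨_, ⟨y, s, h₁, h₂, h₃, rfl⟩, hlt⟩ :=
          exists_lt_of_csInf_lt (coneEnvelope_set_nonempty hR ht) h
        exact ⟨y, s, h₂, hlt, h₁, h₃⟩
      · rintro ⟨y, s, h₂, hlt, h₁, h₃⟩
        exact (hU.coneEnvelope_le ht h₁ h₂ h₃).trans_lt hlt
    · simp only [mem_preimage, mem_Iio, mem_union, mem_inter_iff, mem_ofPred_eq, mem_compl_iff, ht,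
        false_and, not_false_eq_true, true_and, false_or]
      rw [coneEnvelope, if_neg ht]
  rw [hset]
  exact (hstrip.inter hopen.measurableSet).union (hstrip.compl.inter (MeasurableSet.const _))

/-- The derivative in a direction of speed less than `R` is determined by the cone envelope, along
rational times. -/
theorem ConeMonotone.hasDerivAt_iff (hU : ConeMonotone T R U) (hR : 0 < R) (x : Torus N) {t : ℝ}
    (ht : t ∈ Ioo 0 T) {q : Vel N} (hq : ‖q‖ < R) (a : ℝ) :
    HasDerivAt (fun h : ℝ => U (x + proj (h • q)) (t + h)) a 0 ↔
      ∀ n : ℕ, ∃ m : ℕ, ∀ h : ℚ, |(h : ℝ)| < 1 / ((m : ℝ) + 1) →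
        |coneEnvelope T R U (x + proj ((h : ℝ) • q), t + h) -
          coneEnvelope T R U (x + proj ((0 : ℝ) • q), t + 0) - h * a| ≤
            1 / ((n : ℝ) + 1) * |(h : ℝ)| := by
  have hmem : ∀ h : ℝ, |h| < min t (T - t) → t + h ∈ Ioo 0 T := fun h hh => by
    have := abs_lt.1 hh
    exact ⟨by linarith [min_le_left t (T - t)], by linarith [min_le_right t (T - t)]⟩
  -- The envelope lies above `U`; and as `‖q‖ < R`, later points of the line lie strictly inside the
  -- cone of earlier ones, so it lies below later values of `U`.
  refine hasDerivAt_zero_iff_rat (g := fun h => coneEnvelope T R U (x + proj (h • q), t + h))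
    (lt_min ht.1 (sub_pos.2 ht.2)) (fun h hh => hU.le_coneEnvelope hR (hmem h hh))
    fun h h' hh hh' hlt => hU.coneEnvelope_le (hmem h hh) (by linarith) (hmem h' hh').2 ?_
  rw [dist_add_left]
  refine (lipschitzWith_proj.dist_le_mul _ _).trans_lt ?_
  rw [dist_eq_norm, ← sub_smul, norm_smul, Real.norm_of_nonpos (sub_nonpos.2 hlt.le)]
  simp only [NNReal.coe_one, one_mul]
  nlinarith

end ConeMonotone

/-! ### Borel selection of the field -/

section Selection

variable {N : ℕ} {T : ℝ} {H₀ : Torus N → ℝ → Vel N → ℝ} {g₀ : Torus N → ℝ}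

/-- For speeds at most `R` the Lagrangian is at most some `C`, so by dynamic programming the value
function loses at most `C` per unit time; the term `C * t` compensates. -/
theorem exists_coneMonotone_valueFun (hL : IsTonelli T (lagrangian H₀))
    (hg₀ : Continuous g₀) (R : ℝ) :
    ∃ C : ℝ, ConeMonotone T R fun x t => valueFun T H₀ g₀ x t + C * t := by
  have hK : IsCompact ((univ : Set (Torus N)) ×ˢ Icc 0 T ×ˢ Metric.closedBall (0 : Vel N) R) :=
    isCompact_univ.prod (isCompact_Icc.prod (isCompact_closedBall _ _))
  obtain ⟨C, hC⟩ := hK.exists_bound_of_continuousOn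
    (hL.continuousOn.mono (prod_mono_right (prod_mono_right (subset_univ _))))
  refine ⟨C, fun x q t s hq ht hts hs => ?_⟩
  have h := intervalIntegral.integral_mono_on hts (μ := volume)
    (f := fun σ => lagrangian H₀ (segment x t q σ) σ q) (g := fun _ => C)
    ((hL.continuousOn_segment x t q).mono (by
      rw [uIcc_of_le hts]; exact Icc_subset_Icc ht hs)).intervalIntegrable
    intervalIntegrable_const fun σ hσ => (le_abs_self _).trans
      (hC (segment x t q σ, σ, q) ⟨mem_univ _, ⟨ht.trans hσ.1, hσ.2.trans hs⟩, by simpa using hq⟩)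
  rw [intervalIntegral.integral_const, smul_eq_mul] at h
  linarith [valueFun_le_segment hL hg₀ x q ht hts hs]

/-- The graph of the set-valued field `𝒲_{g₀}` over `𝕋ᴺ × (0, T)`. -/
def fieldGraph (T : ℝ) (H₀ : Torus N → ℝ → Vel N → ℝ) (g₀ : Torus N → ℝ) :
    Set ((Torus N × ℝ) × Vel N) :=
  {z | z.1.2 ∈ Ioo 0 T ∧ z.2 ∈ fieldSet T H₀ g₀ z.1.1 z.1.2}

theorem hasDerivAt_add_mul_iff {f : ℝ → ℝ} {C t a : ℝ} :
    HasDerivAt f a 0 ↔ HasDerivAt (fun h => f h + C * (t + h)) (a + C) 0 := by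
  have hlin : HasDerivAt (fun h : ℝ => C * (t + h)) C 0 := by
    simpa using ((hasDerivAt_id (0 : ℝ)).const_add t).const_mul C
  refine ⟨fun h => h.add hlin, fun h => ?_⟩
  have := h.sub hlin
  rw [add_sub_cancel_right] at this
  exact this.congr_of_eventuallyEq (Eventually.of_forall fun h => by simp)

theorem measurableSet_fieldGraph (hT : 0 ≤ T) (hL : IsTonelli T (lagrangian H₀))
    (hg₀ : Continuous g₀) : MeasurableSet (fieldGraph T H₀ g₀) := by
  choose C hC using exists_coneMonotone_valueFun hL hg₀
  let E : ℕ → Torus N × ℝ → ℝ := fun R =>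
    coneEnvelope T ((R : ℝ) + 1) fun x t => valueFun T H₀ g₀ x t + C ((R : ℝ) + 1) * t
  have hE : ∀ R, Measurable (E R) := fun R => (hC _).measurable_coneEnvelope (by positivity)
  let L' : (Torus N × ℝ) × Vel N → ℝ := fun z => lagrangian H₀ z.1.1 (projIcc 0 T hT z.1.2) z.2
  have hL' : Measurable L' := by
    have h : Continuous fun z : (Torus N × ℝ) × Vel N =>
        (z.1.1, (projIcc 0 T hT z.1.2 : ℝ), z.2) := by
      have := continuous_projIcc (h := hT)
      fun_prop
    exact (hL.continuousOn.comp_continuous h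
      fun z => ⟨mem_univ _, (projIcc 0 T hT _).2, mem_univ _⟩).measurable
  have hEm : ∀ (R : ℕ) (h : ℝ), Measurable fun z : (Torus N × ℝ) × Vel N =>
      E R (z.1.1 + proj (h • z.2), z.1.2 + h) := by
    intro R h
    refine (hE R).comp (Continuous.measurable ?_)
    have := continuous_proj (N := N)
    fun_prop
  -- Each `R` treats the directions of speed less than `R + 1`. All quantifiers are now countable
  -- and only Borel functions occur.
  have hset : fieldGraph T H₀ g₀ = {z | z.1.2 ∈ Ioo 0 T ∧ ∃ R : ℕ, ‖z.2‖ < (R : ℝ) + 1 ∧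
      ∀ n : ℕ, ∃ m : ℕ, ∀ h : ℚ, |(h : ℝ)| < 1 / ((m : ℝ) + 1) →
        |E R (z.1.1 + proj ((h : ℝ) • z.2), z.1.2 + h) -
          E R (z.1.1 + proj ((0 : ℝ) • z.2), z.1.2 + 0) - h * (-L' z + C ((R : ℝ) + 1))| ≤
            1 / ((n : ℝ) + 1) * |(h : ℝ)|} := by
    ext ⟨⟨x, t⟩, q⟩
    refine and_congr_right fun (ht : t ∈ Ioo 0 T) => ?_
    have key : ∀ R : ℕ, ‖q‖ < (R : ℝ) + 1 → (q ∈ fieldSet T H₀ g₀ x t ↔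
        ∀ n : ℕ, ∃ m : ℕ, ∀ h : ℚ, |(h : ℝ)| < 1 / ((m : ℝ) + 1) →
        |E R (x + proj ((h : ℝ) • q), t + h) - E R (x + proj ((0 : ℝ) • q), t + 0) -
          h * (-L' ((x, t), q) + C ((R : ℝ) + 1))| ≤ 1 / ((n : ℝ) + 1) * |(h : ℝ)|) := by
      intro R hR
      have e : L' ((x, t), q) = lagrangian H₀ x t q := by
        simp only [L', projIcc_of_mem hT (Ioo_subset_Icc_self ht)]
      rw [mem_fieldSet, hasDerivAt_add_mul_iff (C := C ((R : ℝ) + 1)) (t := t), e]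
      exact (hC ((R : ℝ) + 1)).hasDerivAt_iff (by positivity) x ht hR _
    constructor
    · intro h
      obtain ⟨R, hR⟩ := exists_nat_gt ‖q‖
      have hR' : ‖q‖ < (R : ℝ) + 1 := by linarith
      exact ⟨R, hR', (key R hR').1 h⟩
    · rintro ⟨R, hR, h⟩
      exact (key R hR).2 h
  rw [hset]
  simp only [ofPred_exists, ofPred_and, ofPred_forall]
  refine MeasurableSet.inter (measurable_fst.snd measurableSet_Ioo)
    (MeasurableSet.iUnion fun R => MeasurableSet.inter
    (measurableSet_lt (by fun_prop) measurable_const) (MeasurableSet.iInter fun n =>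
      MeasurableSet.iUnion fun m => MeasurableSet.iInter fun h => MeasurableSet.iInter fun _ => ?_))
  refine measurableSet_le (Measurable.abs ?_) measurable_const
  exact ((hEm R h).sub (hEm R 0)).sub ((hL'.neg.add_const _).const_mul _)

theorem injOn_fst_fieldGraph (hL : IsTonelli T (lagrangian H₀)) (hg₀ : Continuous g₀) :
    InjOn Prod.fst (fieldGraph T H₀ g₀) := by
  rintro ⟨⟨x, t⟩, q⟩ h ⟨⟨x', t'⟩, q'⟩ h' heq
  obtain ⟨rfl, rfl⟩ := Prod.mk.inj heq
  exact congrArg (Prod.mk (x, t)) (fieldSet_subsingleton hL hg₀ x h.1 h.2 h'.2)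

open Classical in
theorem exists_isOptimalField (hT : 0 ≤ T) (hL : IsTonelli T (lagrangian H₀))
    (hg₀ : Continuous g₀) : ∃ W : Torus N × ℝ → Vel N, IsOptimalField T H₀ g₀ W := by
  have : StandardBorelSpace ((Torus N × ℝ) × Vel N) := StandardBorelSpace.prod
  let G := fieldGraph T H₀ g₀
  have hG : MeasurableSet G := measurableSet_fieldGraph hT hL hg₀
  have hinj : InjOn Prod.fst G := injOn_fst_fieldGraph hL hg₀
  let W : Torus N × ℝ → Vel N := fun z => if h : ∃ q, (z, q) ∈ G then h.choose else 0
  have hW : ∀ z q, (z, q) ∈ G → W z = q := by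
    intro z q hq
    have hex : ∃ q, (z, q) ∈ G := ⟨q, hq⟩
    have : W z = hex.choose := dif_pos hex
    rw [this]
    exact congrArg Prod.snd (hinj hex.choose_spec hq rfl)
  refine ⟨W, fun B hB => ?_, fun x t ht ⟨q, hq⟩ => ?_⟩
  · have hpre : W ⁻¹' B = (Prod.fst '' (G ∩ Prod.snd ⁻¹' B)) ∪
        ((Prod.fst '' G)ᶜ ∩ {_z : Torus N × ℝ | (0 : Vel N) ∈ B}) := by
      ext z
      by_cases hz : ∃ q, (z, q) ∈ G
      · obtain ⟨q, hq⟩ := hz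
        simp only [mem_preimage, hW z q hq, mem_union, mem_image, mem_inter_iff, Prod.exists,
          exists_and_right, exists_eq_right, mem_compl_iff, mem_ofPred_eq]
        constructor
        · exact fun h => Or.inl ⟨q, hq, h⟩
        · rintro (⟨q', hq', h⟩ | ⟨h, -⟩)
          · rwa [← hW z q hq, hW z q' hq']
          · exact absurd ⟨q, hq⟩ h
      · have hW0 : W z = 0 := dif_neg hz
        simp only [mem_preimage, hW0, mem_union, mem_image, mem_inter_iff, Prod.exists,
          exists_and_right, exists_eq_right, mem_compl_iff, mem_ofPred_eq]
        constructor
        · exact fun h => Or.inr ⟨hz, h⟩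
        · rintro (⟨q', hq', -⟩ | ⟨-, h⟩)
          · exact absurd ⟨q', hq'⟩ hz
          · exact h
    rw [hpre]
    have hd : MeasurableSet (Prod.fst '' G) := hG.image_of_measurable_injOn measurable_fst hinj
    exact ((hG.inter (measurable_snd hB)).image_of_measurable_injOn measurable_fst
      (hinj.mono inter_subset_left)).union (hd.compl.inter (MeasurableSet.const _))
  · rw [hW (x, t) q ⟨ht, hq⟩]
    exact (fieldSet_subsingleton hL hg₀ x ht).eq_singleton_of_mem hq

end Selection

/-! ### Lifting curves to `ℝᴺ` -/

section Lift

variable {N : ℕ} {ζ : ℝ → Torus N} {c : ℝ → Vel N} {a b : ℝ}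

theorem exists_continuous_lift (hζ : Continuous ζ) :
    ∃ c : ℝ → Vel N, Continuous c ∧ ∀ s, proj (c s) = ζ s := by
  have h : ∀ i : Fin N, ∃ F : C(ℝ, ℝ), ∀ s, ((F s : ℝ) : UnitAddCircle) = ζ s i := by
    intro i
    obtain ⟨r, hr⟩ := QuotientAddGroup.mk_surjective (ζ 0 i)
    obtain ⟨F, ⟨-, hF⟩, -⟩ := (AddCircle.isCoveringMap_coe (1 : ℝ)).existsUnique_continuousMap_lifts
      (⟨fun s => ζ s i, by fun_prop⟩ : C(ℝ, UnitAddCircle)) 0 r hr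
    exact ⟨F, fun s => congrFun hF s⟩
  choose F hF using h
  refine ⟨fun s => WithLp.toLp 2 fun i => F i s, by fun_prop, fun s => ?_⟩
  ext i
  exact hF i s

open AbsolutelyContinuousOnInterval in
theorem absolutelyContinuousOnInterval_lift (hζ : AbsolutelyContinuousOnInterval ζ a b)
    (hc : Continuous c) (h : ∀ s, proj (c s) = ζ s) : AbsolutelyContinuousOnInterval c a b := by
  have huc : UniformContinuousOn c (uIcc a b) :=
    isCompact_uIcc.uniformContinuousOn_of_continuous hc.continuousOn
  -- On intervals shorter than `δ₀` the lift moves by less than `1 / 2`, where the projection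
  -- preserves norms; the two variation sums then coincide.
  obtain ⟨δ₀, hδ₀, H₀⟩ := Metric.uniformContinuousOn_iff.1 huc (1 / 2) (by norm_num)
  rw [absolutelyContinuousOnInterval_iff] at hζ ⊢
  intro ε hε
  obtain ⟨δ, hδ, H⟩ := hζ ε hε
  refine ⟨min δ δ₀, lt_min hδ hδ₀, fun E hE hEδ => ?_⟩
  convert! H E hE (hEδ.trans_le (min_le_left _ _)) using 1
  refine Finset.sum_congr rfl fun i hi => ?_
  have hlt : dist (E.2 i).1 (E.2 i).2 < δ₀ :=
    (Finset.single_le_sum (f := fun i => dist (E.2 i).1 (E.2 i).2) (fun _ _ => dist_nonneg)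
      hi).trans_lt (hEδ.trans_le (min_le_right _ _))
  have hd := H₀ _ (hE.1 i hi).1 _ (hE.1 i hi).2 hlt
  rw [dist_eq_norm] at hd
  rw [← h, ← h, dist_eq_norm, dist_eq_norm, ← proj_sub, norm_proj_eq hd]

theorem ae_hasDerivAt_lift (hab : a ≤ b) (hc : AbsolutelyContinuousOnInterval c a b)
    (h : ∀ s, proj (c s) = ζ s) :
    ∀ᵐ t, t ∈ Ioo a b → HasDerivAt c (velocity ζ t) t := by
  filter_upwards [hc.boundedVariationOn.locallyBoundedVariationOn.ae_differentiableWithinAt_of_mem]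
    with t ht htab
  rw [uIcc_of_le hab] at ht
  have hd := ((ht (Ioo_subset_Icc_self htab)).differentiableAt (Icc_mem_nhds htab.1 htab.2)).hasDerivAt
  have hv : HasVelocityAt ζ (deriv c t) t := ⟨c, hd, Eventually.of_forall fun s => (h s).symm⟩
  rwa [hv.velocity_eq]

theorem exists_absolutelyContinuous_lift (hab : a ≤ b) (hζ : Continuous ζ)
    (hac : AbsolutelyContinuousOnInterval ζ a b) :
    ∃ c : ℝ → Vel N, AbsolutelyContinuousOnInterval c a b ∧ (∀ s, proj (c s) = ζ s) ∧
      ∀ᵐ t, t ∈ Ioo a b → HasDerivAt c (velocity ζ t) t := by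
  obtain ⟨c, hc, h⟩ := exists_continuous_lift hζ
  have hcac := absolutelyContinuousOnInterval_lift hac hc h
  exact ⟨c, hcac, h, ae_hasDerivAt_lift hab hcac h⟩

end Lift

/-! ### Optimal curves move with the field -/

section OptimalVelocity

variable {N : ℕ} {T : ℝ} {H₀ : Torus N → ℝ → Vel N → ℝ} {g₀ : Torus N → ℝ}

/-- The hypothesis controls `v` along the curve, the conclusion along its tangent. For `h > 0`, one
path runs from `x` along the tangent to `x + h q`, bounding `v` there from below; another runs from
`x + h q` to `ζ(t + 2h)` with velocity close to `q`, bounding it from above. For `h < 0` the two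
roles are exchanged. -/
theorem mem_fieldSet_of_hasDerivAt (hL : IsTonelli T (lagrangian H₀)) (hg₀ : Continuous g₀)
    {ζ : ℝ → Torus N} {c : ℝ → Vel N} (hc : ∀ s, proj (c s) = ζ s) {t : ℝ} (ht : t ∈ Ioo 0 T)
    {q : Vel N} (hq : HasDerivAt c q t)
    (hv : HasDerivAt (fun h : ℝ => valueFun T H₀ g₀ (ζ (t + h)) (t + h))
      (-lagrangian H₀ (ζ t) t q) 0) : q ∈ fieldSet T H₀ g₀ (ζ t) t := by
  rw [mem_fieldSet, hasDerivAt_zero_iff]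
  intro ε' hε'
  -- One `ε` is spent on the connecting segment and two on the difference quotient at `2 * h`.
  obtain ⟨ε, hε, rfl⟩ : ∃ ε > 0, ε' = 3 * ε := ⟨ε' / 3, by positivity, by ring⟩
  set x := ζ t with hx
  set l := lagrangian H₀ x t q
  obtain ⟨δ, hδ, H⟩ := valueFun_le_of_near hL hg₀ x ht q hε
  obtain ⟨δ₁, hδ₁, H₁⟩ := hasDerivAt_zero_iff.1 hv ε hε
  obtain ⟨δ₂, hδ₂, H₂⟩ := Metric.eventually_nhds_iff.1
    ((hasDerivAt_iff_isLittleO.1 hq).def (by positivity : 0 < δ / 4))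
  obtain ⟨δ₃, hδ₃, H₃⟩ := Metric.continuousAt_iff.1 hq.continuousAt δ hδ
  have hQ : 0 < ‖q‖ + 1 := by positivity
  set η := min (min (δ₁ / 2) (δ₂ / 2)) (min (min (δ₃ / 2) (δ / 2)) (δ / (‖q‖ + 1)))
  have hη : 0 < η := lt_min (lt_min (half_pos hδ₁) (half_pos hδ₂))
    (lt_min (lt_min (half_pos hδ₃) (half_pos hδ)) (by positivity))
  have b1 : η ≤ δ₁ / 2 := (min_le_left _ _).trans (min_le_left _ _)
  have b2 : η ≤ δ₂ / 2 := (min_le_left _ _).trans (min_le_right _ _)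
  have b3 : η ≤ δ₃ / 2 := (min_le_right _ _).trans ((min_le_left _ _).trans (min_le_left _ _))
  have b4 : η ≤ δ / 2 := (min_le_right _ _).trans ((min_le_left _ _).trans (min_le_right _ _))
  have b5 : η ≤ δ / (‖q‖ + 1) := (min_le_right _ _).trans (min_le_right _ _)
  rw [le_div_iff₀ hQ] at b5
  have hxc : proj (c t) = x := hc t
  have hqq : dist q q < δ := by rwa [dist_self]
  simp only [zero_smul, proj_zero, add_zero]
  simp only [add_zero, ← hx] at H₁
  -- the slope of the curve over a time interval of length `2 |h|` is close to `q`
  have hslope : ∀ h : ℝ, h ≠ 0 → |h| < η →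
      dist (h⁻¹ • (c (t + 2 * h) - c t - h • q)) q < δ := by
    intro h h0 hh
    have h2 : |2 * h| < δ₂ := by rw [abs_mul, abs_two]; linarith
    have := H₂ (y := t + 2 * h) (by rwa [Real.dist_eq, add_sub_cancel_left])
    rw [add_sub_cancel_left, Real.norm_eq_abs, abs_mul, abs_two] at this
    have e : h⁻¹ • (c (t + 2 * h) - c t - h • q) - q =
        h⁻¹ • (c (t + 2 * h) - c t - (2 * h) • q) := by
      rw [smul_sub, smul_sub _ _ ((2 * h) • q), smul_smul, smul_smul]
      rw [inv_mul_cancel₀ h0, show h⁻¹ * (2 * h) = 2 by field_simp]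
      module
    have hpos : 0 < |h| := abs_pos.2 h0
    rw [dist_eq_norm, e, norm_smul, norm_inv, Real.norm_eq_abs, inv_mul_lt_iff₀ hpos]
    nlinarith
  refine ⟨η, hη, fun h hh => ?_⟩
  have hxq : dist (x + proj (h • q)) x < δ := by
    rw [dist_eq_norm, add_sub_cancel_left]
    refine (norm_proj_le _).trans_lt ?_
    rw [norm_smul, Real.norm_eq_abs]
    nlinarith [norm_nonneg q, abs_nonneg h]
  have h2 : |2 * h| < δ₁ := by rw [abs_mul, abs_two]; linarith
  have hv2 := abs_le.1 (H₁ (2 * h) h2)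
  rcases lt_trichotomy h 0 with hneg | rfl | hpos
  · rw [abs_mul, abs_two, abs_of_neg hneg] at hv2
    rw [abs_of_neg hneg] at hh ⊢
    have up := H (x + proj (h • q)) (t + h) t q hxq (by linarith) (by linarith) (by linarith) hqq
    have e1 : x + proj (h • q) + proj ((t - (t + h)) • q) = x := by
      rw [add_assoc, ← proj_add, ← add_smul]
      simp [proj_zero]
    rw [e1] at up
    have hs := hslope h hneg.ne (by rwa [abs_of_neg hneg])
    have lo := H (ζ (t + 2 * h)) (t + 2 * h) (t + h) (h⁻¹ • (c (t + 2 * h) - c t - h • q)) (by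
      rw [← hc, ← hxc]
      refine (lipschitzWith_proj.dist_le_mul _ _).trans_lt ?_
      rw [NNReal.coe_one, one_mul]
      refine H₃ ?_
      rw [Real.dist_eq, add_sub_cancel_left, abs_mul, abs_two, abs_of_neg hneg]
      linarith) (by linarith) (by linarith) (by linarith) hs
    have e2 : ζ (t + 2 * h) +
        proj ((t + h - (t + 2 * h)) • h⁻¹ • (c (t + 2 * h) - c t - h • q)) = x + proj (h • q) := by
      rw [← hc, ← hxc, ← proj_add, ← proj_add, smul_smul,
        show (t + h - (t + 2 * h)) * h⁻¹ = -1 by field_simp [hneg.ne]; ring]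
      congr 1
      module
    rw [e2] at lo
    rw [abs_le]
    constructor <;> linarith
  · simp [proj_zero]
  · rw [abs_mul, abs_two, abs_of_pos hpos] at hv2
    rw [abs_of_pos hpos] at hh ⊢
    have lo := H x t (t + h) q (by rwa [dist_self]) (by linarith) (by linarith) (by linarith) hqq
    rw [add_sub_cancel_left] at lo
    have hs := hslope h hpos.ne' (by rwa [abs_of_pos hpos])
    have up := H (x + proj (h • q)) (t + h) (t + 2 * h) (h⁻¹ • (c (t + 2 * h) - c t - h • q)) hxq
      (by linarith) (by linarith) (by linarith) hs
    have e2 : x + proj (h • q) +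
        proj ((t + 2 * h - (t + h)) • h⁻¹ • (c (t + 2 * h) - c t - h • q)) = ζ (t + 2 * h) := by
      rw [← hc, ← hxc, ← proj_add, ← proj_add, smul_smul,
        show (t + 2 * h - (t + h)) * h⁻¹ = 1 by field_simp [hpos.ne']; ring]
      congr 1
      module
    rw [e2] at up
    rw [abs_le]
    constructor <;> linarith

end OptimalVelocity

section OptimalVelocity

variable {N : ℕ} {T : ℝ} {H₀ : Torus N → ℝ → Vel N → ℝ} {g₀ : Torus N → ℝ}
  {W : Torus N × ℝ → Vel N}

/-- An optimal curve lifts to an absolutely continuous curve in `ℝᴺ` that moves with the velocity given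
by the optimal field. -/
theorem IsOptimalCurve.exists_lift {hT : 0 ≤ T} (hL : IsTonelli T (lagrangian H₀))
    (hg₀ : Continuous g₀) (hW : IsOptimalField T H₀ g₀ W) {ζ : CurveSpace N T}
    (hζ : IsOptimalCurve hT H₀ g₀ ζ) :
    ∃ c : ℝ → Vel N, AbsolutelyContinuousOnInterval c 0 T ∧ (∀ s, proj (c s) = ζ.ext hT s) ∧
      ∀ᵐ t, t ∈ Ioo 0 T → HasDerivAt c (W (ζ.ext hT t, t)) t ∧
        velocity (ζ.ext hT) t = W (ζ.ext hT t, t) := by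
  have hadm := hζ.isAdmissible hL
  obtain ⟨c, hcac, hc, hcd⟩ :=
    exists_absolutelyContinuous_lift hT (CurveSpace.continuous_ext hT ζ) hadm.1
  refine ⟨c, hcac, hc, ?_⟩
  filter_upwards [hcd, hadm.2.ae_hasDerivAt_integral] with t h₁ h₂ ht
  have hq := h₁ ht
  have hd := h₂ (by rw [uIcc_of_le hT]; exact Ioo_subset_Icc_self ht) T right_mem_uIcc
  have hv : HasDerivAt (fun h : ℝ => valueFun T H₀ g₀ (ζ.ext hT (t + h)) (t + h))
      (-lagrangian H₀ (ζ.ext hT t) t (velocity (ζ.ext hT) t)) 0 := by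
    -- Along an optimal curve the value function is a constant minus the running cost, so its
    -- derivative is `-L` wherever the primitive of the running cost is differentiable with
    -- derivative `L`.
    have hd' : HasDerivAt (fun s : ℝ => g₀ (ζ.ext hT T) - ∫ r in T..s,
        lagrangian H₀ (ζ.ext hT r) r (velocity (ζ.ext hT) r))
        (-lagrangian H₀ (ζ.ext hT t) t (velocity (ζ.ext hT) t)) (t + 0) := by
      rw [add_zero]
      exact hd.const_sub _
    refine (hd'.comp_const_add t 0).congr_of_eventuallyEq ?_
    have hnear : ∀ᶠ h : ℝ in 𝓝 0, t + h ∈ Ioo 0 T :=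
      (by fun_prop : Continuous fun h : ℝ => t + h).continuousAt.eventually
        (by beta_reduce; rw [add_zero]; exact Ioo_mem_nhds ht.1 ht.2)
    filter_upwards [hnear] with h hh
    rw [hζ.valueFun_eq hL hg₀ (Ioo_subset_Icc_self hh), intervalIntegral.integral_symm,
      sub_neg_eq_add, actionIntegral]
  have hmem := mem_fieldSet_of_hasDerivAt hL hg₀ hc ht hq hv
  have hset := hW.2 _ t ht ⟨_, hmem⟩
  rw [hset, mem_singleton_iff] at hmem
  exact ⟨hmem ▸ hq, hmem⟩

/-- Used twice: `r = 1` gives integrability of the field, and the conjugate exponent gives the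
integrability asked for in (ii). -/
theorem IsOptimalCurve.lintegral_rpow_le {hT : 0 ≤ T} (hL : IsTonelli T (lagrangian H₀))
    (hg₀ : Continuous g₀) (hW : IsOptimalField T H₀ g₀ W) {ζ : CurveSpace N T}
    (hζ : IsOptimalCurve hT H₀ g₀ ζ) {r C A : ℝ}
    (hC : ∀ x : Torus N, ∀ t ∈ Icc 0 T, ∀ q : Vel N, ‖q‖ ^ r ≤ lagrangian H₀ x t q + C)
    (hA : actionIntegral (lagrangian H₀) (ζ.ext hT) 0 T ≤ A) :
    ∫⁻ t in Ioc 0 T, ENNReal.ofReal (‖W (ζ.ext hT t, t)‖ ^ r) ≤ ENNReal.ofReal (A + C * T) := by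
  obtain ⟨c, -, -, hc⟩ := hζ.exists_lift hL hg₀ hW
  have hint := (hζ.isAdmissible hL).2
  have hT' : ∀ᵐ t : ℝ, t ≠ T := by simp [ae_iff, measure_singleton]
  have hle : ∀ᵐ t ∂(volume.restrict (Ioc 0 T)), ENNReal.ofReal (‖W (ζ.ext hT t, t)‖ ^ r) ≤
      ENNReal.ofReal (lagrangian H₀ (ζ.ext hT t) t (velocity (ζ.ext hT) t) + C) := by
    rw [ae_restrict_iff' measurableSet_Ioc]
    filter_upwards [hc, hT'] with t h htT ht
    rw [← (h ⟨ht.1, lt_of_le_of_ne ht.2 htT⟩).2]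
    exact ENNReal.ofReal_le_ofReal (hC _ t (Ioc_subset_Icc_self ht) _)
  have hint' : IntervalIntegrable
      (fun t => lagrangian H₀ (ζ.ext hT t) t (velocity (ζ.ext hT) t) + C) volume 0 T :=
    hint.add intervalIntegrable_const
  refine (lintegral_mono_ae hle).trans ?_
  rw [← ofReal_integral_eq_lintegral_ofReal
    ((intervalIntegrable_iff_integrableOn_Ioc_of_le hT).1 hint'),
    ← intervalIntegral.integral_of_le hT,
    intervalIntegral.integral_add hint intervalIntegrable_const, intervalIntegral.integral_const]
  · refine ENNReal.ofReal_le_ofReal (add_le_add hA ?_)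
    simp [mul_comm]
  · rw [EventuallyLE, ae_restrict_iff' measurableSet_Ioc]
    refine Eventually.of_forall fun t ht => ?_
    exact (Real.rpow_nonneg (norm_nonneg _) r).trans (hC _ t (Ioc_subset_Icc_self ht) _)

open AbsolutelyContinuousOnInterval in
theorem _root_.AbsolutelyContinuousOnInterval.of_dist_le {X Y Z : Type*} [PseudoMetricSpace X]
    [PseudoMetricSpace Y] [PseudoMetricSpace Z] {f : ℝ → X} {g : ℝ → Y} {F : ℝ → Z} {a b K : ℝ}
    (hf : AbsolutelyContinuousOnInterval f a b) (hg : AbsolutelyContinuousOnInterval g a b)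
    (h : ∀ s ∈ uIcc a b, ∀ s' ∈ uIcc a b,
      dist (F s) (F s') ≤ K * (dist (f s) (f s') + dist (g s) (g s'))) :
    AbsolutelyContinuousOnInterval F a b := by
  have hlim := (Tendsto.add hf hg).const_mul K
  rw [add_zero, mul_zero] at hlim
  refine squeeze_zero' (Eventually.of_forall fun E => Finset.sum_nonneg fun i _ => dist_nonneg)
    ?_ hlim
  filter_upwards [mem_inf_of_right (mem_principal_self (disjWithin a b))] with E hE
  rw [← Finset.sum_add_distrib, Finset.mul_sum]
  exact Finset.sum_le_sum fun i hi => h _ (hE.1 i hi).1 _ (hE.1 i hi).2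

theorem norm_sub_le_integral_of_ae_hasDerivAt {c w : ℝ → Vel N} {a b : ℝ} (hab : a ≤ b)
    (hc : AbsolutelyContinuousOnInterval c a b)
    (hw : ∀ᵐ t, t ∈ Ioo a b → HasDerivAt c (w t) t) (hint : IntervalIntegrable w volume a b) :
    ‖c b - c a‖ ≤ ∫ t in a..b, ‖w t‖ := by
  set e := c b - c a
  -- Pairing with the increment `e` reduces the bound to the scalar fundamental theorem of calculus.
  have hF : AbsolutelyContinuousOnInterval (fun t => inner ℝ e (c t)) a b := by
    refine hc.of_dist_le hc (K := ‖e‖) fun s _ s' _ => ?_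
    rw [Real.dist_eq, ← inner_sub_right, dist_eq_norm]
    refine (abs_real_inner_le_norm _ _).trans ?_
    gcongr
    linarith [norm_nonneg (c s - c s')]
  have hb : ∀ᵐ t : ℝ, t ≠ b := by simp [ae_iff, measure_singleton]
  have hint' : IntervalIntegrable (fun t => inner ℝ e (w t)) volume a b :=
    ⟨hint.1.const_inner e, hint.2.const_inner e⟩
  have h1 : ‖e‖ * ‖e‖ = ∫ t in a..b, inner ℝ e (w t) := by
    rw [← real_inner_self_eq_norm_mul_norm]
    calc inner ℝ e e = inner ℝ e (c b) - inner ℝ e (c a) := by rw [← inner_sub_right]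
      _ = ∫ t in a..b, deriv (fun t => inner ℝ e (c t)) t := hF.integral_deriv_eq_sub.symm
      _ = _ := by
        refine intervalIntegral.integral_congr_ae ?_
        filter_upwards [hw, hb] with t h htb ht
        rw [uIoc_of_le hab] at ht
        exact ((hasDerivAt_const t e).inner ℝ (h ⟨ht.1, lt_of_le_of_ne ht.2 htb⟩)).deriv.trans
          (by simp)
  have h2 : ∫ t in a..b, inner ℝ e (w t) ≤ ∫ t in a..b, ‖e‖ * ‖w t‖ :=
    intervalIntegral.integral_mono_on hab hint' (hint.norm.const_mul _)
      fun t _ => real_inner_le_norm _ _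
  rw [intervalIntegral.integral_const_mul, ← h1] at h2
  rcases (norm_nonneg e).eq_or_lt with h | h
  · rw [← h]
    exact intervalIntegral.integral_nonneg hab fun t _ => norm_nonneg _
  · exact le_of_mul_le_mul_left h2 h

end OptimalVelocity

/-! ### Test functions and the chain rule -/

section Transport

variable {N : ℕ} {T : ℝ} {φ : Torus N → ℝ → ℝ}

/-- The lift of a function on `𝕋ᴺ × ℝ` to `ℝᴺ × ℝ`. -/
def liftFun (φ : Torus N → ℝ → ℝ) (z : Vel N × ℝ) : ℝ := φ (proj z.1) z.2

theorem IsC1.hasFDerivAt (hφ : IsC1 T φ) (a : Vel N) {t : ℝ} (ht : t ∈ Ioo 0 T) :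
    HasFDerivAt (liftFun φ) (fderiv ℝ (liftFun φ) (a, t)) (a, t) := by
  have h : ContDiffAt ℝ 1 (liftFun φ) (a, t) :=
    ContDiffOn.contDiffAt hφ (prod_mem_nhds univ_mem (Icc_mem_nhds ht.1 ht.2))
  exact (h.differentiableAt one_ne_zero).hasFDerivAt

theorem IsC1.transport_eq (hφ : IsC1 T φ) (a : Vel N) {t : ℝ} (ht : t ∈ Ioo 0 T) (w : Vel N) :
    transport T φ (proj a) t w = fderiv ℝ (liftFun φ) (a, t) (w, 1) := by
  have hd := hφ.hasFDerivAt a ht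
  have h1 : HasDerivAt (fun s => φ (proj a) s) (fderiv ℝ (liftFun φ) (a, t) (0, 1)) t :=
    HasFDerivAt.comp_hasDerivAt (f := fun s => (a, s)) t hd
      ((hasDerivAt_const t a).prodMk (hasDerivAt_id t))
  have h2 : HasFDerivAt (fun y : Vel N => φ (proj a + proj y) t)
      ((fderiv ℝ (liftFun φ) (a, t)).comp (ContinuousLinearMap.inl ℝ (Vel N) ℝ)) 0 := by
    have hd' : HasFDerivAt (liftFun φ) (fderiv ℝ (liftFun φ) (a, t)) (a + 0, t) := by
      rwa [add_zero]
    have := HasFDerivAt.comp (f := fun y : Vel N => (a + y, t)) 0 hd'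
      (((hasFDerivAt_id (0 : Vel N)).const_add a).prodMk (hasFDerivAt_const t 0))
    refine (this.congr_of_eventuallyEq (Eventually.of_forall fun y => ?_)).congr_fderiv rfl
    simp only [Function.comp, liftFun, proj_add]
  rw [transport, derivWithin_of_mem_nhds (Icc_mem_nhds ht.1 ht.2), h1.deriv, h2.fderiv,
    ContinuousLinearMap.comp_apply, ContinuousLinearMap.inl_apply, ← map_add]
  simp

/-- The derivative within the closed slab is continuous up to `t = 0` and `t = T`, hence bounded on
compact sets, and it agrees with the full derivative at interior times. -/
theorem IsC1.exists_norm_fderiv_le (hφ : IsC1 T φ) (hT : 0 < T) (ρ : ℝ) :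
    ∃ M : ℝ, 0 ≤ M ∧ ∀ a : Vel N, ‖a‖ ≤ ρ → ∀ t ∈ Ioo 0 T,
      ‖fderiv ℝ (liftFun φ) (a, t)‖ ≤ M := by
  have hu : UniqueDiffOn ℝ ((univ : Set (Vel N)) ×ˢ Icc 0 T) :=
    uniqueDiffOn_univ.prod (uniqueDiffOn_Icc hT)
  have hc := ContDiffOn.continuousOn_fderivWithin (f := liftFun φ) hφ hu le_rfl
  have hK : IsCompact (Metric.closedBall (0 : Vel N) ρ ×ˢ Icc 0 T) :=
    (isCompact_closedBall _ _).prod isCompact_Icc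
  obtain ⟨M, hM⟩ := hK.exists_bound_of_continuousOn (hc.mono (prod_mono_left (subset_univ _)))
  refine ⟨max M 0, le_max_right _ _, fun a ha t ht => le_max_of_le_left ?_⟩
  have := hM (a, t) ⟨by simpa using ha, Ioo_subset_Icc_self ht⟩
  rwa [fderivWithin_of_mem_nhds (prod_mem_nhds univ_mem (Icc_mem_nhds ht.1 ht.2))] at this

theorem IsC1.exists_dist_le (hφ : IsC1 T φ) (hT : 0 < T) (ρ : ℝ) :
    ∃ K : ℝ, ∀ a b : Vel N, ‖a‖ ≤ ρ → ‖b‖ ≤ ρ → ∀ t ∈ Icc 0 T, ∀ s ∈ Icc 0 T,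
      dist (φ (proj a) t) (φ (proj b) s) ≤ K * (dist a b + dist t s) := by
  have hu : UniqueDiffOn ℝ ((univ : Set (Vel N)) ×ˢ Icc 0 T) :=
    uniqueDiffOn_univ.prod (uniqueDiffOn_Icc hT)
  have hc := ContDiffOn.continuousOn_fderivWithin (f := liftFun φ) hφ hu le_rfl
  have hK : IsCompact (Metric.closedBall (0 : Vel N) ρ ×ˢ Icc 0 T) :=
    (isCompact_closedBall _ _).prod isCompact_Icc
  have hsub : Metric.closedBall (0 : Vel N) ρ ×ˢ Icc 0 T ⊆ univ ×ˢ Icc 0 T :=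
    prod_mono_left (subset_univ _)
  obtain ⟨M, hM⟩ := hK.exists_bound_of_continuousOn (hc.mono hsub)
  refine ⟨max M 0, fun a b ha hb t ht s hs => ?_⟩
  have hconv : Convex ℝ (Metric.closedBall (0 : Vel N) ρ ×ˢ Icc 0 T) :=
    (convex_closedBall _ _).prod (convex_Icc _ _)
  have h := hconv.norm_image_sub_le_of_norm_hasFDerivWithin_le (f := liftFun φ)
    (f' := fderivWithin ℝ (liftFun φ) (univ ×ˢ Icc 0 T))
    (fun z hz => ((ContDiffOn.differentiableOn hφ one_ne_zero z (hsub hz)).hasFDerivWithinAt.mono hsub))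
    hM (x := (b, s)) (y := (a, t)) ⟨by simpa using hb, hs⟩ ⟨by simpa using ha, ht⟩
  rw [dist_eq_norm]
  refine h.trans (mul_le_mul (le_max_left _ _) ?_ (norm_nonneg _) (le_max_right _ _))
  rw [Prod.norm_def]
  exact max_le ((dist_eq_norm a b).symm.le.trans (le_add_of_nonneg_right dist_nonneg))
    ((dist_eq_norm t s).symm.le.trans (le_add_of_nonneg_left dist_nonneg))

/-- The chain rule along an absolutely continuous curve. -/
theorem IsC1.integral_transport_eq (hφ : IsC1 T φ) (hT : 0 < T) {c w : ℝ → Vel N}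
    (hc : AbsolutelyContinuousOnInterval c 0 T)
    (hw : ∀ᵐ t, t ∈ Ioo 0 T → HasDerivAt c (w t) t) :
    ∫ t in (0 : ℝ)..T, transport T φ (proj (c t)) t (w t) =
      φ (proj (c T)) T - φ (proj (c 0)) 0 := by
  obtain ⟨ρ, hρ⟩ := hc.exists_bound
  obtain ⟨K, hK⟩ := hφ.exists_dist_le hT ρ
  have hid : AbsolutelyContinuousOnInterval (id : ℝ → ℝ) 0 T :=
    LipschitzWith.id.lipschitzOnWith.absolutelyContinuousOnInterval
  -- The lift of `φ` is Lipschitz on the ball that contains the bounded curve `c`.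
  have hF : AbsolutelyContinuousOnInterval (fun t => φ (proj (c t)) t) 0 T :=
    hc.of_dist_le hid fun s hs s' hs' => hK _ _ (hρ s hs) (hρ s' hs') s (by rwa [uIcc_of_le hT.le] at hs)
      s' (by rwa [uIcc_of_le hT.le] at hs')
  rw [← hF.integral_deriv_eq_sub]
  have hT' : ∀ᵐ t : ℝ, t ≠ T := by simp [ae_iff, measure_singleton]
  refine intervalIntegral.integral_congr_ae ?_
  filter_upwards [hw, hT'] with t h htT ht
  rw [uIoc_of_le hT.le] at ht
  have ht' : t ∈ Ioo 0 T := ⟨ht.1, lt_of_le_of_ne ht.2 htT⟩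
  rw [hφ.transport_eq _ ht']
  exact (HasFDerivAt.comp_hasDerivAt (f := fun s => (c s, s)) t (hφ.hasFDerivAt (c t) ht')
    ((h ht').prodMk (hasDerivAt_id t))).deriv.symm

end Transport

/-! ### Joint measurability and a bounded Borel section -/

section Measurability

theorem CurveSpace.continuous_eval_uncurried {N : ℕ} {T : ℝ} (hT : 0 ≤ T) :
    Continuous fun p : CurveSpace N T × ℝ => p.1.ext hT p.2 := by
  have := continuous_projIcc (h := hT)
  exact (by fun_prop : Continuous fun p : CurveSpace N T × ℝ => p.1 (projIcc 0 T hT p.2))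

theorem CurveSpace.measurable_eval_pair {N : ℕ} {T : ℝ} (hT : 0 ≤ T) :
    Measurable fun p : CurveSpace N T × ℝ => (p.1.ext hT p.2, p.2) :=
  (CurveSpace.continuous_eval_uncurried hT).measurable.prodMk measurable_snd

/-- Coordinates in `(0, 1]` give the bound `√N`. The section transfers measurability and bounds from
lifted test functions to the torus. -/
theorem exists_measurable_section (N : ℕ) : ∃ σ : Torus N → Vel N, Measurable σ ∧
    (∀ x, proj (σ x) = x) ∧ ∃ ρ : ℝ, ∀ x, ‖σ x‖ ≤ ρ := by
  let e := AddCircle.measurableEquivIoc (1 : ℝ) 0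
  refine ⟨fun x => WithLp.toLp 2 fun i => (e (x i) : ℝ), ?_, fun x => ?_, √N, fun x => ?_⟩
  · have h : ∀ i, Measurable fun x : Torus N => (e (x i) : ℝ) := fun i =>
      measurable_subtype_coe.comp (e.measurable.comp (by fun_prop))
    exact (WithLp.measurable_toLp 2 (Fin N → ℝ)).comp (measurable_pi_iff.2 h)
  · ext i
    exact (AddCircle.equivIoc (1 : ℝ) 0).symm_apply_apply (x i)
  · rw [EuclideanSpace.norm_eq]
    refine Real.sqrt_le_sqrt ?_
    refine (Finset.sum_le_card_nsmul Finset.univ _ 1 fun i _ => ?_).trans (by simp)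
    have := (e (x i)).2
    simp only [mem_Ioc, zero_add] at this
    rw [Real.norm_of_nonneg this.1.le]
    exact pow_le_one₀ this.1.le this.2

end Measurability

/-! ### The continuity equation for optimal measures -/

section OptimalMeasure

variable {N : ℕ} {T : ℝ} {H₀ : Torus N → ℝ → Vel N → ℝ} {g₀ : Torus N → ℝ}
  {W : Torus N × ℝ → Vel N}

theorem coe_evalCurve (hT : 0 ≤ T) (ξ : ProbabilityMeasure (CurveSpace N T)) (t : ℝ) :
    (evalCurve hT ξ t : Measure (Torus N)) =
      (ξ : Measure (CurveSpace N T)).map fun ζ => ζ.ext hT t :=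
  ProbabilityMeasure.toMeasure_map _ _

theorem continuous_evalCurve (hT : 0 ≤ T) (ξ : ProbabilityMeasure (CurveSpace N T)) :
    Continuous (evalCurve hT ξ) := by
  refine continuous_iff_continuousAt.2 fun t => ?_
  refine ProbabilityMeasure.tendsto_iff_forall_integral_tendsto.2 fun f => ?_
  have e : ∀ s, ∫ x, f x ∂(evalCurve hT ξ s : Measure (Torus N)) =
      ∫ ζ, f (ζ.ext hT s) ∂(ξ : Measure (CurveSpace N T)) := fun s => by
    rw [coe_evalCurve]
    exact integral_map (CurveSpace.continuous_eval hT s).measurable.aemeasurable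
      f.continuous.aestronglyMeasurable
  simp only [e]
  refine tendsto_integral_filter_of_dominated_convergence (fun _ => ‖f‖)
    (Eventually.of_forall fun s =>
      (f.continuous.comp (CurveSpace.continuous_eval hT s)).aestronglyMeasurable)
    (Eventually.of_forall fun s => Eventually.of_forall fun ζ => f.norm_coe_le_norm _)
    (integrable_const _) (Eventually.of_forall fun ζ => ?_)
  exact (f.continuous.comp (CurveSpace.continuous_ext hT ζ)).continuousAt

/-- The integral of a power of the speed with respect to an optimal measure is finite. -/
theorem lintegral_lintegral_rpow_lt_top {hT : 0 ≤ T} (hL : IsTonelli T (lagrangian H₀))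
    (hg₀ : Continuous g₀) (hW : IsOptimalField T H₀ g₀ W)
    {ξ : ProbabilityMeasure (CurveSpace N T)} (hξ : IsOptimalMeasure hT H₀ g₀ ξ) {r C : ℝ}
    (hC : ∀ x : Torus N, ∀ t ∈ Icc 0 T, ∀ q : Vel N, ‖q‖ ^ r ≤ lagrangian H₀ x t q + C) :
    ∫⁻ ζ, ∫⁻ t in Ioc 0 T, ENNReal.ofReal (‖W (ζ.ext hT t, t)‖ ^ r)
      ∂volume ∂(ξ : Measure (CurveSpace N T)) < ⊤ := by
  obtain ⟨A, hA⟩ := exists_actionIntegral_optimal_le (g₀ := g₀) hT hL hg₀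
  refine (lintegral_mono_ae (g := fun _ => ENNReal.ofReal (A + C * T)) ?_).trans_lt ?_
  · filter_upwards [hξ] with ζ hζ
    exact hζ.lintegral_rpow_le hL hg₀ hW hC (hA ζ hζ)
  · simp

theorem integrable_velocity {hT : 0 ≤ T} (hL : IsTonelli T (lagrangian H₀))
    (hg₀ : Continuous g₀) (hW : IsOptimalField T H₀ g₀ W)
    {ξ : ProbabilityMeasure (CurveSpace N T)} (hξ : IsOptimalMeasure hT H₀ g₀ ξ) :
    Integrable (fun p : CurveSpace N T × ℝ => W (p.1.ext hT p.2, p.2))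
      ((ξ : Measure (CurveSpace N T)).prod (volume.restrict (Ioc 0 T))) := by
  have hm : Measurable fun p : CurveSpace N T × ℝ => W (p.1.ext hT p.2, p.2) :=
    hW.1.comp (CurveSpace.measurable_eval_pair hT)
  refine ⟨hm.aestronglyMeasurable, ?_⟩
  obtain ⟨C, -, hC⟩ := hL.coercive
  have h := lintegral_lintegral_rpow_lt_top hL hg₀ hW hξ (r := 1) (C := C) fun x t ht q => by
    rw [Real.rpow_one]
    linarith [hC x t ht q]
  rw [HasFiniteIntegral, lintegral_prod _ hm.enorm.aemeasurable]
  simpa only [Real.rpow_one, ofReal_norm] using h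

theorem lintegral_enorm_evalCurve (hT : 0 ≤ T) (hW : Measurable W)
    (ξ : ProbabilityMeasure (CurveSpace N T)) (t : ℝ) :
    ∫⁻ x, ‖W (x, t)‖ₑ ∂(evalCurve hT ξ t : Measure (Torus N)) =
      ∫⁻ ζ, ‖W (ζ.ext hT t, t)‖ₑ ∂(ξ : Measure (CurveSpace N T)) := by
  rw [coe_evalCurve]
  exact lintegral_map (hW.comp measurable_prodMk_right).enorm
    (CurveSpace.continuous_eval hT t).measurable

theorem lintegral_enorm_field_lt_top {hT : 0 ≤ T} (hL : IsTonelli T (lagrangian H₀))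
    (hg₀ : Continuous g₀) (hW : IsOptimalField T H₀ g₀ W)
    {ξ : ProbabilityMeasure (CurveSpace N T)} (hξ : IsOptimalMeasure hT H₀ g₀ ξ) :
    ∫⁻ t in Icc 0 T, ∫⁻ x, ‖W (x, t)‖ₑ ∂(evalCurve hT ξ t : Measure (Torus N)) < ⊤ := by
  simp only [lintegral_enorm_evalCurve hT hW.1]
  rw [← restrict_Ioc_eq_restrict_Icc, ← lintegral_lintegral_swap
    (f := fun (ζ : CurveSpace N T) t => ‖W (ζ.ext hT t, t)‖ₑ)
    (hW.1.comp (CurveSpace.measurable_eval_pair hT)).enorm.aemeasurable,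
    ← lintegral_prod (fun p : CurveSpace N T × ℝ => ‖W (p.1.ext hT p.2, p.2)‖ₑ)
    (hW.1.comp (CurveSpace.measurable_eval_pair hT)).enorm.aemeasurable]
  exact (integrable_velocity hL hg₀ hW hξ).2

theorem IsC1.continuous_apply_proj {φ : Torus N → ℝ → ℝ} (hφ : IsC1 T φ) {t : ℝ}
    (ht : t ∈ Icc 0 T) : Continuous fun a : Vel N => φ (proj a) t :=
  ContDiffOn.continuousOn hφ |>.comp_continuous (f := fun a : Vel N => (a, t)) (by fun_prop)
    fun _ => ⟨mem_univ _, ht⟩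

theorem IsC1.integral_evalCurve {φ : Torus N → ℝ → ℝ} (hφ : IsC1 T φ) (hT : 0 ≤ T)
    (ξ : ProbabilityMeasure (CurveSpace N T)) {t : ℝ} (ht : t ∈ Icc 0 T) :
    Integrable (fun ζ : CurveSpace N T => φ (ζ.ext hT t) t) (ξ : Measure (CurveSpace N T)) ∧
      ∫ x, φ x t ∂(evalCurve hT ξ t : Measure (Torus N)) =
        ∫ ζ, φ (ζ.ext hT t) t ∂(ξ : Measure (CurveSpace N T)) := by
  obtain ⟨σ, hσ, hσx, ρ, hρ⟩ := exists_measurable_section N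
  have hc := hφ.continuous_apply_proj ht
  have hm : Measurable fun x => φ x t := by
    have := hc.measurable.comp hσ
    simpa only [Function.comp_def, hσx] using this
  obtain ⟨M, hM⟩ := (isCompact_closedBall (0 : Vel N) ρ).exists_bound_of_continuousOn
    hc.continuousOn
  have hev := (CurveSpace.continuous_eval (N := N) hT t).measurable
  refine ⟨Integrable.of_bound (hm.comp hev).aestronglyMeasurable M
    (Eventually.of_forall fun ζ => ?_), ?_⟩
  · have := hM (σ (ζ.ext hT t)) (by simpa using hρ _)
    rwa [hσx] at this
  · rw [coe_evalCurve]
    exact integral_map hev.aemeasurable hm.aestronglyMeasurable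

theorem integral_transport_evalCurve (hT : 0 < T) (hL : IsTonelli T (lagrangian H₀))
    (hg₀ : Continuous g₀) (hW : IsOptimalField T H₀ g₀ W)
    {ξ : ProbabilityMeasure (CurveSpace N T)} (hξ : IsOptimalMeasure hT.le H₀ g₀ ξ)
    {φ : Torus N → ℝ → ℝ} (hφ : IsC1 T φ) :
    ∫ t in (0 : ℝ)..T, ∫ x, transport T φ x t (W (x, t)) ∂(evalCurve hT.le ξ t : Measure (Torus N)) =
      (∫ x, φ x T ∂(evalCurve hT.le ξ T : Measure (Torus N))) -
        ∫ x, φ x 0 ∂(evalCurve hT.le ξ 0 : Measure (Torus N)) := by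
  obtain ⟨σ, hσ, hσx, ρ, hρ⟩ := exists_measurable_section N
  obtain ⟨M, hM0, hM⟩ := hφ.exists_norm_fderiv_le hT ρ
  -- A Borel expression of the integrand, equal to `transport` at interior times.
  let G : Torus N × ℝ → ℝ := fun z => fderiv ℝ (liftFun φ) (σ z.1, z.2) (W z, 1)
  have hG : Measurable G := by
    have h1 : Measurable fun z : Torus N × ℝ =>
        (fderiv ℝ (liftFun φ) (σ z.1, z.2), (W z, (1 : ℝ))) :=
      ((measurable_fderiv ℝ (liftFun φ)).comp
        ((hσ.comp measurable_fst).prodMk measurable_snd)).prodMk (hW.1.prodMk measurable_const)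
    exact (isBoundedBilinearMap_apply (𝕜 := ℝ) (E := Vel N × ℝ) (F := ℝ)).continuous.measurable.comp
      h1
  have hGt : ∀ t ∈ Ioo 0 T, ∀ x, transport T φ x t (W (x, t)) = G (x, t) := fun t ht x => by
    have := hφ.transport_eq (σ x) ht (W (x, t))
    rwa [hσx] at this
  have hT' : ∀ᵐ t : ℝ, t ≠ T := by simp [ae_iff, measure_singleton]
  have hint : Integrable (fun p : CurveSpace N T × ℝ => G (p.1.ext hT.le p.2, p.2))
      ((ξ : Measure (CurveSpace N T)).prod (volume.restrict (Ioc 0 T))) := by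
    refine Integrable.mono' (g := fun p : CurveSpace N T × ℝ =>
      M * (‖W (p.1.ext hT.le p.2, p.2)‖ + 1))
      (((integrable_velocity hL hg₀ hW hξ).norm.add (integrable_const _)).const_mul _)
      (hG.comp (CurveSpace.measurable_eval_pair hT.le)).aestronglyMeasurable ?_
    have hae : ∀ᵐ p ∂((ξ : Measure (CurveSpace N T)).prod (volume.restrict (Ioc 0 T))),
        p.2 ∈ Ioo 0 T := by
      refine Measure.quasiMeasurePreserving_snd.ae (p := fun t => t ∈ Ioo 0 T) ?_
      rw [ae_restrict_iff' measurableSet_Ioc]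
      filter_upwards [hT'] with t htT ht
      exact ⟨ht.1, lt_of_le_of_ne ht.2 htT⟩
    filter_upwards [hae] with p hp
    refine (ContinuousLinearMap.le_opNorm _ _).trans
      (mul_le_mul (hM _ (hρ _) _ hp) ?_ (norm_nonneg _) hM0)
    rw [Prod.norm_def]
    exact max_le (le_add_of_nonneg_right zero_le_one) (by simp)
  have h1 : ∀ᵐ t, t ∈ uIoc 0 T →
      ∫ x, transport T φ x t (W (x, t)) ∂(evalCurve hT.le ξ t : Measure (Torus N)) =
        ∫ ζ, G (ζ.ext hT.le t, t) ∂(ξ : Measure (CurveSpace N T)) := by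
    filter_upwards [hT'] with t htT ht
    rw [uIoc_of_le hT.le] at ht
    simp only [hGt t ⟨ht.1, lt_of_le_of_ne ht.2 htT⟩]
    rw [coe_evalCurve]
    exact integral_map (CurveSpace.continuous_eval hT.le t).measurable.aemeasurable
      (hG.comp measurable_prodMk_right).aestronglyMeasurable
  rw [intervalIntegral.integral_congr_ae h1, intervalIntegral.integral_of_le hT.le,
    -- After Fubini the inner integral runs along a single curve, where the chain rule applies.
    ← integral_integral_swap (f := fun (ζ : CurveSpace N T) t => G (ζ.ext hT.le t, t)) hint]
  obtain ⟨iT, eT⟩ := hφ.integral_evalCurve hT.le ξ (right_mem_Icc.2 hT.le)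
  obtain ⟨i0, e0⟩ := hφ.integral_evalCurve hT.le ξ (left_mem_Icc.2 hT.le)
  rw [eT, e0, ← integral_sub iT i0]
  refine integral_congr_ae ?_
  filter_upwards [hξ] with ζ hζ
  obtain ⟨c, hcac, hc, hd⟩ := hζ.exists_lift hL hg₀ hW
  have h2 := hφ.integral_transport_eq hT hcac
    (w := fun t => W (ζ.ext hT.le t, t)) (hd.mono fun t h ht => (h ht).1)
  rw [hc, hc] at h2
  rw [← h2, ← intervalIntegral.integral_of_le hT.le]
  refine intervalIntegral.integral_congr_ae ?_
  filter_upwards [hT'] with t htT ht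
  rw [uIoc_of_le hT.le] at ht
  rw [hc]
  exact (hGt t ⟨ht.1, lt_of_le_of_ne ht.2 htT⟩ _).symm

theorem solvesContinuityEq_evalCurve (hT : 0 < T) (hL : IsTonelli T (lagrangian H₀))
    (hg₀ : Continuous g₀) (hW : IsOptimalField T H₀ g₀ W)
    {ξ : ProbabilityMeasure (CurveSpace N T)} (hξ : IsOptimalMeasure hT.le H₀ g₀ ξ) :
    SolvesContinuityEq T (evalCurve hT.le ξ) W :=
  ⟨(continuous_evalCurve hT.le ξ).continuousOn, lintegral_enorm_field_lt_top hL hg₀ hW hξ,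
    fun _ hφ => integral_transport_evalCurve hT hL hg₀ hW hξ hφ⟩

end OptimalMeasure

/-! ### Absolute continuity in the Wasserstein distance -/

section Wasserstein

variable {N : ℕ} {T : ℝ} {H₀ : Torus N → ℝ → Vel N → ℝ} {g₀ : Torus N → ℝ}
  {W : Torus N × ℝ → Vel N}

/-- The joint law of `(ζ(t₁), ζ(t₂))` under `ξ` is a transport plan. -/
theorem wasserstein_evalCurve_le (hT : 0 ≤ T) (ξ : ProbabilityMeasure (CurveSpace N T))
    (t₁ t₂ : ℝ) : wasserstein (evalCurve hT ξ t₁) (evalCurve hT ξ t₂) ≤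
      ∫⁻ ζ, edist (ζ.ext hT t₁) (ζ.ext hT t₂) ∂(ξ : Measure (CurveSpace N T)) := by
  have h1 := (CurveSpace.continuous_eval (N := N) hT t₁).measurable
  have h2 := (CurveSpace.continuous_eval (N := N) hT t₂).measurable
  have hf : ((ξ : Measure (CurveSpace N T)).map fun ζ => (ζ.ext hT t₁, ζ.ext hT t₂)).map Prod.fst =
      (evalCurve hT ξ t₁ : Measure (Torus N)) := by
    rw [Measure.map_map measurable_fst (h1.prodMk h2), coe_evalCurve, Function.comp_def]
  have hs : ((ξ : Measure (CurveSpace N T)).map fun ζ => (ζ.ext hT t₁, ζ.ext hT t₂)).map Prod.snd =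
      (evalCurve hT ξ t₂ : Measure (Torus N)) := by
    rw [Measure.map_map measurable_snd (h1.prodMk h2), coe_evalCurve, Function.comp_def]
  have hle : wasserstein (evalCurve hT ξ t₁) (evalCurve hT ξ t₂) ≤ ∫⁻ z, edist z.1 z.2
      ∂((ξ : Measure (CurveSpace N T)).map fun ζ => (ζ.ext hT t₁, ζ.ext hT t₂)) :=
    iInf_le_of_le _ (iInf_le _ ⟨hf, hs⟩)
  rwa [lintegral_map (f := fun z : Torus N × Torus N => edist z.1 z.2)
    continuous_edist.measurable (h1.prodMk h2)] at hle

theorem IsOptimalCurve.edist_le {hT : 0 ≤ T} (hL : IsTonelli T (lagrangian H₀))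
    (hg₀ : Continuous g₀) (hW : IsOptimalField T H₀ g₀ W) {ζ : CurveSpace N T}
    (hζ : IsOptimalCurve hT H₀ g₀ ζ)
    (hint : IntegrableOn (fun t => W (ζ.ext hT t, t)) (Ioc 0 T)) {t₁ t₂ : ℝ} (h₁ : 0 ≤ t₁)
    (h₁₂ : t₁ ≤ t₂) (h₂ : t₂ ≤ T) :
    edist (ζ.ext hT t₁) (ζ.ext hT t₂) ≤ ∫⁻ t in Ioc t₁ t₂, ‖W (ζ.ext hT t, t)‖ₑ := by
  obtain ⟨c, hcac, hc, hd⟩ := hζ.exists_lift hL hg₀ hW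
  have hint' : IntegrableOn (fun t => W (ζ.ext hT t, t)) (Ioc t₁ t₂) :=
    hint.mono_set (Ioc_subset_Ioc h₁ h₂)
  have h := norm_sub_le_integral_of_ae_hasDerivAt h₁₂
    (hcac.mono (by rw [uIcc_of_le hT, uIcc_of_le h₁₂]; exact Icc_subset_Icc h₁ h₂))
    (w := fun t => W (ζ.ext hT t, t)) (hd.mono fun t h ht => (h (Ioo_subset_Ioo h₁ h₂ ht)).1)
    ((intervalIntegrable_iff_integrableOn_Ioc_of_le h₁₂).2 hint')
  rw [← ofReal_integral_norm_eq_lintegral_enorm hint', ← intervalIntegral.integral_of_le h₁₂,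
    edist_dist, ← hc, ← hc]
  refine ENNReal.ofReal_le_ofReal (le_trans ?_ h)
  rw [← dist_eq_norm, dist_comm (c t₂)]
  simpa using lipschitzWith_proj.dist_le_mul (c t₁) (c t₂)

theorem UniformlySuperpower.exists_rpow_le {L : Torus N → ℝ → Vel N → ℝ} {r : ℝ} (hr : 0 ≤ r)
    (hL : IsTonelli T L) (h : UniformlySuperpower T r L) :
    ∃ C : ℝ, ∀ x : Torus N, ∀ t ∈ Icc 0 T, ∀ q : Vel N, ‖q‖ ^ r ≤ L x t q + C := by
  obtain ⟨R, hR⟩ := h 1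
  obtain ⟨C, hC0, hC⟩ := hL.coercive
  refine ⟨max R 0 ^ r + C, fun x t ht q => ?_⟩
  have h0 : 0 ≤ max R 0 ^ r := Real.rpow_nonneg (le_max_right _ _) r
  by_cases hq : ‖q‖ ≤ max R 0
  · have := Real.rpow_le_rpow (norm_nonneg q) hq hr
    linarith [hC x t ht q, norm_nonneg q]
  · have hq' := not_le.1 hq
    have hq0 : 0 < ‖q‖ := (le_max_right _ _).trans_lt hq'
    have := hR x t ht q ((le_max_left _ _).trans_lt hq') hq0
    rw [le_div_iff₀ (Real.rpow_pos_of_pos hq0 r)] at this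
    linarith

theorem isACMeasureCurve_evalCurve {hT : 0 ≤ T} (hL : IsTonelli T (lagrangian H₀))
    (hg₀ : Continuous g₀) (hW : IsOptimalField T H₀ g₀ W)
    {ξ : ProbabilityMeasure (CurveSpace N T)} (hξ : IsOptimalMeasure hT H₀ g₀ ξ) {r : ℝ}
    (hr : 1 ≤ r) (hsuper : UniformlySuperpower T r (lagrangian H₀)) :
    IsACMeasureCurve T r (evalCurve hT ξ) := by
  have hr0 : 0 < r := zero_lt_one.trans_le hr
  have hint := integrable_velocity hL hg₀ hW hξ
  have hm : Measurable fun p : CurveSpace N T × ℝ => W (p.1.ext hT p.2, p.2) :=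
    hW.1.comp (CurveSpace.measurable_eval_pair hT)
  -- The mean speed at time `t`. Distances along each curve are bounded by the integral of the
  -- speed, and Fubini turns their mean into the integral of `f`.
  set f : ℝ → ℝ := fun t => ∫ ζ, ‖W (ζ.ext hT t, t)‖ ∂(ξ : Measure (CurveSpace N T)) with hf
  have hfint : IntegrableOn f (Ioc 0 T) := hint.norm.integral_prod_right
  refine ⟨f, ⟨?_, ?_⟩, fun t₁ h₁ t₂ h₂ h₁₂ => ?_⟩
  · rw [← restrict_Ioc_eq_restrict_Icc]
    exact hfint.aestronglyMeasurable
  · rw [eLpNorm_lt_top_iff_lintegral_rpow_enorm_lt_top (by simpa using hr0) ENNReal.ofReal_ne_top,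
      ENNReal.toReal_ofReal hr0.le, ← restrict_Ioc_eq_restrict_Icc]
    obtain ⟨C, hC⟩ := hsuper.exists_rpow_le hr0.le hL
    have hfin := lintegral_lintegral_rpow_lt_top hL hg₀ hW hξ hC
    rw [lintegral_lintegral_swap
      (f := fun (ζ : CurveSpace N T) t => ENNReal.ofReal (‖W (ζ.ext hT t, t)‖ ^ r))
      (hm.norm.pow_const r).ennreal_ofReal.aemeasurable] at hfin
    refine (lintegral_mono fun t => ?_).trans_lt hfin
    have hmt : Measurable fun ζ : CurveSpace N T => W (ζ.ext hT t, t) :=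
      hm.comp measurable_prodMk_right
    -- Jensen's inequality for the probability measure `ξ`.
    have h1 := eLpNorm'_le_eLpNorm'_of_exponent_le one_pos hr (ξ : Measure (CurveSpace N T))
      hmt.aestronglyMeasurable
    have h2 : ‖f t‖ₑ ≤ ∫⁻ ζ, ‖W (ζ.ext hT t, t)‖ₑ ∂(ξ : Measure (CurveSpace N T)) := by
      refine (enorm_integral_le_lintegral_enorm _).trans_eq ?_
      simp only [enorm_norm]
    rw [eLpNorm', eLpNorm'] at h1
    simp only [ENNReal.rpow_one, div_one] at h1
    calc ‖f t‖ₑ ^ r ≤ ((∫⁻ ζ, ‖W (ζ.ext hT t, t)‖ₑ ^ r ∂(ξ : Measure (CurveSpace N T))) ^ (1 / r)) ^ r :=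
          ENNReal.rpow_le_rpow (h2.trans h1) hr0.le
      _ = ∫⁻ ζ, ‖W (ζ.ext hT t, t)‖ₑ ^ r ∂(ξ : Measure (CurveSpace N T)) := by
          rw [one_div, ENNReal.rpow_inv_rpow hr0.ne']
      _ = _ := by
          refine lintegral_congr fun ζ => ?_
          rw [← ofReal_norm, ENNReal.ofReal_rpow_of_nonneg (norm_nonneg _) hr0.le]
  · have hsub : Ioc t₁ t₂ ⊆ Ioc 0 T := Ioc_subset_Ioc h₁.1 h₂.2
    calc wasserstein (evalCurve hT ξ t₁) (evalCurve hT ξ t₂)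
        ≤ ∫⁻ ζ, edist (ζ.ext hT t₁) (ζ.ext hT t₂) ∂(ξ : Measure (CurveSpace N T)) :=
          wasserstein_evalCurve_le hT ξ t₁ t₂
      _ ≤ ∫⁻ ζ, ∫⁻ t in Ioc t₁ t₂, ‖W (ζ.ext hT t, t)‖ₑ ∂volume
            ∂(ξ : Measure (CurveSpace N T)) := by
          refine lintegral_mono_ae ?_
          filter_upwards [hξ, hint.prod_right_ae] with ζ hζ hi
          exact hζ.edist_le hL hg₀ hW hi h₁.1 h₁₂.le h₂.2
      _ = ∫⁻ t in Ioc t₁ t₂, ∫⁻ ζ, ‖W (ζ.ext hT t, t)‖ₑ ∂(ξ : Measure (CurveSpace N T)) :=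
          lintegral_lintegral_swap hm.enorm.aemeasurable
      _ = ∫⁻ t in Ioc t₁ t₂, ENNReal.ofReal (f t) := by
          refine lintegral_congr_ae ?_
          filter_upwards [ae_restrict_of_ae_restrict_of_subset hsub hint.prod_left_ae] with t ht
          exact (ofReal_integral_norm_eq_lintegral_enorm ht).symm
      _ = ENNReal.ofReal (∫ t in t₁..t₂, f t) := by
          rw [intervalIntegral.integral_of_le h₁₂.le, ofReal_integral_eq_lintegral_ofReal
            (hfint.mono_set hsub)
            (Eventually.of_forall fun t => integral_nonneg fun ζ => norm_nonneg _)]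

end Wasserstein

end MFG

end

theorem mainTheorem3 (N : ℕ) (T : ℝ) (hT : 0 < T)
    (H₀ : MFG.Torus N → ℝ → MFG.Vel N → ℝ)
    (hcont : MFG.IsContHam T H₀)
    (hconv : MFG.IsConvexHam T H₀)
    (hsuper : MFG.UniformlySuperpower T 1 H₀)
    (hdiff : MFG.IsDiffHam T H₀)
    (g₀ : MFG.Torus N → ℝ) (hg₀ : Continuous g₀) :
    (∃ W : MFG.Torus N × ℝ → MFG.Vel N, MFG.IsOptimalField T H₀ g₀ W) ∧
    ∀ ξ : ProbabilityMeasure (MFG.CurveSpace N T), MFG.IsOptimalMeasure hT.le H₀ g₀ ξ →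
      (∀ W : MFG.Torus N × ℝ → MFG.Vel N, MFG.IsOptimalField T H₀ g₀ W →
        MFG.SolvesContinuityEq T (MFG.evalCurve hT.le ξ) W) ∧
      (∀ ε₀ : ℝ, 0 < ε₀ →
        MFG.UniformlySuperpower T (Real.conjExponent (1 + ε₀)) (MFG.lagrangian H₀) →
        MFG.IsACMeasureCurve T (Real.conjExponent (1 + ε₀)) (MFG.evalCurve hT.le ξ)) := by
  have hL := MFG.isTonelli_lagrangian hT.le hcont hsuper hdiff
  obtain ⟨W₀, hW₀⟩ := MFG.exists_isOptimalField (g₀ := g₀) hT.le hL hg₀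
  refine ⟨⟨W₀, hW₀⟩, fun ξ hξ => ⟨fun W hW => MFG.solvesContinuityEq_evalCurve hT hL hg₀ hW hξ,
    fun ε₀ hε₀ hsuper' => MFG.isACMeasureCurve_evalCurve hL hg₀ hW₀ hξ ?_ hsuper'⟩⟩
  -- The remaining claim is `1 ≤ (1 + ε₀) / ε₀`.
  rw [Real.conjExponent, add_sub_cancel_left, le_div_iff₀ hε₀]
  linarith
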